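/- Let $p$ be a prime number and let $n \geq 1$ be an integer. Let $\mathcal{R}_n$ be the ring of virtual ordinary characters of the symmetric group $\mathfrak{S}_n$, that is, the ring (under pointwise operations) of all functions $\mathfrak{S}_n \to \mathbb{C}$ that are differences of two characters of finite-dimensional complex representations of $\mathfrak{S}_n$, and let $\bar{\mathcal{R}}_n = \mathcal{R}_n / p\mathcal{R}_n$, a commutative $\mathbb{F}_p$-algebra. Then the Loewy length of $\bar{\mathcal{R}}_n$, i.e. the least integer $l \geq 0$ such that $(\operatorname{Rad} \bar{\mathcal{R}}_n)^l = 0$, where $\operatorname{Rad}$ denotes the Jacobson radical, is equal to $\lfloor n/p \rfloor + 1$. -/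

import Mathlib

noncomputable section

/-- `f : G → ℂ` is an (ordinary) character of `G`: the character `g ↦ tr (ρ g)` of some
finite-dimensional complex representation `ρ` of `G`. -/
def IsOrdinaryCharacter {G : Type} [Group G] (f : G → ℂ) : Prop :=
  ∃ (V : Type) (_ : AddCommGroup V) (_ : Module ℂ V) (_ : FiniteDimensional ℂ V)
    (ρ : Representation ℂ G V), f = ρ.character

namespace IsOrdinaryCharacter

variable {G : Type} [Group G]

theorem zero : IsOrdinaryCharacter (0 : G → ℂ) :=
  ⟨PUnit, inferInstance, inferInstance, inferInstance, Representation.trivial ℂ G PUnit, by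
    funext g; simp [Representation.character]⟩

theorem one : IsOrdinaryCharacter (1 : G → ℂ) :=
  ⟨ℂ, inferInstance, inferInstance, inferInstance, Representation.trivial ℂ G ℂ, by
    funext g; simp [Representation.character]⟩

theorem add {f f' : G → ℂ} (h : IsOrdinaryCharacter f) (h' : IsOrdinaryCharacter f') :
    IsOrdinaryCharacter (f + f') := by
  obtain ⟨V, _, _, _, ρ, rfl⟩ := h
  obtain ⟨W, _, _, _, σ, rfl⟩ := h'
  refine ⟨V × W, inferInstance, inferInstance, inferInstance, ρ.prod σ, ?_⟩
  funext g
  exact (LinearMap.trace_prodMap' (ρ g) (σ g)).symm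

theorem mul {f f' : G → ℂ} (h : IsOrdinaryCharacter f) (h' : IsOrdinaryCharacter f') :
    IsOrdinaryCharacter (f * f') := by
  obtain ⟨V, _, _, _, ρ, rfl⟩ := h
  obtain ⟨W, _, _, _, σ, rfl⟩ := h'
  exact ⟨TensorProduct ℂ V W, inferInstance, inferInstance, inferInstance, ρ.tprod σ,
    (Representation.char_tensor ρ σ).symm⟩

end IsOrdinaryCharacter

/-- The ring of virtual ordinary characters of `G`: all differences of two characters, as a
subring of the ring of functions `G → ℂ` with pointwise operations. -/
def virtualCharacterRing (G : Type) [Group G] : Subring (G → ℂ) where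
  carrier := {f | ∃ a b : G → ℂ, IsOrdinaryCharacter a ∧ IsOrdinaryCharacter b ∧ f = a - b}
  zero_mem' := ⟨0, 0, .zero, .zero, by simp⟩
  one_mem' := ⟨1, 0, .one, .zero, by simp⟩
  add_mem' := by
    rintro _ _ ⟨a, b, ha, hb, rfl⟩ ⟨c, d, hc, hd, rfl⟩
    exact ⟨a + c, b + d, ha.add hc, hb.add hd, by ring⟩
  neg_mem' := by
    rintro _ ⟨a, b, ha, hb, rfl⟩
    exact ⟨b, a, hb, ha, by ring⟩
  mul_mem' := by
    rintro _ _ ⟨a, b, ha, hb, rfl⟩ ⟨c, d, hc, hd, rfl⟩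
    exact ⟨a * c + b * d, a * d + b * c, (ha.mul hc).add (hb.mul hd),
      (ha.mul hd).add (hb.mul hc), by ring⟩

/-- The ring `𝓡ₙ` of virtual ordinary characters of the symmetric group of degree `n`. -/
abbrev symmCharacterRing (n : ℕ) : Type :=
  virtualCharacterRing (Equiv.Perm (Fin n))

/-- The reduction `𝓡ₙ / p𝓡ₙ`. -/
abbrev symmCharacterRingMod (n p : ℕ) : Type :=
  symmCharacterRing n ⧸ Ideal.span {(p : symmCharacterRing n)}

/-- The natural `𝔽_p`-algebra structure on `𝓡ₙ / p𝓡ₙ`. -/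
instance symmCharacterRingMod.algebra (n p : ℕ) : Algebra (ZMod p) (symmCharacterRingMod n p) :=
  RingHom.toAlgebra
    ((Ideal.Quotient.lift (Ideal.span {(p : ℤ)})
      (Int.castRingHom (symmCharacterRingMod n p)) (by
        intro a ha
        obtain ⟨c, rfl⟩ := Ideal.mem_span_singleton.mp ha
        have h : ((p : ℕ) : symmCharacterRingMod n p) = 0 := by
          have := Ideal.Quotient.eq_zero_iff_mem.mpr
            (Ideal.mem_span_singleton_self (p : symmCharacterRing n))
          simpa using this
        simp [h])).comp (Int.quotientSpanNatEquivZMod p).symm.toRingHom)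

/-- The Loewy length of a commutative algebra `A` over a field `k`: the least `l` with
`(Rad A) ^ l = 0`, where `Rad A` is the Jacobson radical (and `⊤` if there is no such `l`).
Neither the radical nor its powers, which are ideals, depend on `k`. -/
def loewyLength (k A : Type*) [Field k] [CommRing A] [Algebra k A] : ℕ∞ :=
  ⨅ (l : ℕ) (_ : Ring.jacobson A ^ l = ⊥), (l : ℕ∞)

end

/-!
The proof works with the Young characters `youngChar n a`: for a content `a : C → ℕ` this is the
permutation character of `𝔖ₙ` on the colourings of `n` points with `a i` points of colour `i`.
Its value at `w` counts the colourings of content `a` that are constant on the cycles of `w`.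

*Spanning.* The Young characters of the partitions of `n` span `𝓡ₙ` over `ℤ`
(`mem_span_partitionChar`). For `f` in `𝓡ₙ`, the pairings of `sgn · f` with the Young characters
are integers, and they are the coefficients of a symmetric polynomial. The fundamental theorem on
symmetric polynomials writes it in terms of elementary symmetric polynomials. The coefficients of a
product of these count zero-one matrices with given row and column sums, and so do the pairings of
`sgn` times one Young character with another (`sum_sign_mul_invariantColorings`,
`coeff_prod_esymm`). Hence `f` and an integral combination of Young characters have the same
pairings with all Young characters, and they are equal because the matrix of values of the Young
characters is triangular (`eq_zero_of_forall_sum_mul_youngChar`).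

*Radical.* Call a content `p`-singular if `p` colours have the same positive content. A virtual
character in the radical modulo `p` has all its values divisible by `p`. The same triangularity,
with diagonal entries prime to `p` at `p`-regular partitions, shows that the radical lies in the
ideal generated by the `p`-singular Young characters (`jacobson_le_span_partitionChar`).

*Upper bound.* A product of `k` Young characters is, by Mackey's formula (`prod_youngChar`), the sum
of the Young characters of the contents on the product of the `k` colour sets with prescribed
marginals. If all factors are `p`-singular, then `(ℤ/p)^k` acts on these contents. A content fixed
by this action is positive at `pk` colours at least (`mul_card_le_of_stable`), which is impossible
if `pk > n`. So for `k = ⌊n/p⌋ + 1` all orbits have length divisible by `p`, and the product lies in `p𝓡ₙ`.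

*Lower bound.* Let `x` be the number of fixed points. Modulo `p`, the polynomials `((X)_p) ^ k` and
`(X)_{pk}` agree (falling factorials), so that `(x)_p` is nilpotent modulo `p`. For `pk ≤ n` the
average of `(x)_{pk}` over `𝔖ₙ` is `1`, because `𝔖ₙ` is transitive on injective `pk`-tuples. The
average of an element of `p𝓡ₙ` is divisible by `p`. So `((x)_p) ^ ⌊n/p⌋` is nonzero modulo `p`.
-/

noncomputable section

/-! ### Characters and averages -/

/-- The permutation character of a finite `G`-set is an ordinary character. -/
theorem isOrdinaryCharacter_card_fixedBy {G : Type} [Group G] (X : Type) [Finite X]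
    [MulAction G X] :
    IsOrdinaryCharacter (fun g : G => (Nat.card (MulAction.fixedBy X g) : ℂ)) := by
  classical
  have := Fintype.ofFinite X
  refine ⟨X → ℂ, inferInstance, inferInstance, inferInstance,
    { toFun := fun g => LinearMap.funLeft ℂ ℂ (fun x : X => g⁻¹ • x)
      map_one' := by ext; simp
      map_mul' := fun g h => by ext; simp [LinearMap.funLeft_apply, mul_smul] }, ?_⟩
  funext g
  rw [Representation.character, LinearMap.trace_eq_matrix_trace ℂ (Pi.basisFun ℂ X), Matrix.trace,
    Nat.card_eq_fintype_card, Fintype.card_subtype]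
  simp [LinearMap.funLeft_apply, Pi.single_apply, eq_comm]
  refine congrArg _ (Finset.filter_congr fun x _ => ?_)
  rw [eq_inv_smul_iff, eq_comm]

theorem isOrdinaryCharacter_sign (α : Type) [Fintype α] [DecidableEq α] :
    IsOrdinaryCharacter (fun w : Equiv.Perm α => ((Equiv.Perm.sign w : ℤ) : ℂ)) := by
  refine ⟨ℂ, inferInstance, inferInstance, inferInstance,
    ((algebraMap ℂ (Module.End ℂ ℂ)).toMonoidHom.comp
      ((Int.castRingHom ℂ).toMonoidHom.comp (Units.coeHom ℤ))).comp Equiv.Perm.sign, ?_⟩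
  funext w
  change _ = LinearMap.trace ℂ ℂ (algebraMap ℂ (Module.End ℂ ℂ) ((Equiv.Perm.sign w : ℤ) : ℂ))
  rw [Algebra.algebraMap_eq_smul_one, map_smul, LinearMap.trace_one]
  simp

theorem IsOrdinaryCharacter.mem_virtualCharacterRing {G : Type} [Group G] {f : G → ℂ}
    (h : IsOrdinaryCharacter f) : f ∈ virtualCharacterRing G :=
  ⟨f, 0, h, .zero, by simp⟩

theorem virtualCharacterRing.apply_conj {G : Type} [Group G] {f : G → ℂ}
    (hf : f ∈ virtualCharacterRing G) (g h : G) : f (h * g * h⁻¹) = f g := by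
  obtain ⟨_, _, ⟨V, _, _, _, ρ, rfl⟩, ⟨W, _, _, _, σ, rfl⟩, rfl⟩ := hf
  simp

/-- The average of a virtual character over the group is an integer, being a difference of
dimensions of spaces of invariants. -/
theorem virtualCharacterRing.exists_sum_eq {G : Type} [Group G] [Fintype G] {f : G → ℂ}
    (hf : f ∈ virtualCharacterRing G) : ∃ z : ℤ, ∑ g, f g = Fintype.card G * z := by
  have key : ∀ a : G → ℂ, IsOrdinaryCharacter a → ∃ z : ℤ, ∑ g, a g = Fintype.card G * z := by
    rintro _ ⟨V, _, _, _, ρ, rfl⟩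
    have h0 : (Nat.card G : ℂ) ≠ 0 := by exact_mod_cast Nat.card_pos.ne'
    have : Invertible (Nat.card G : ℂ) := invertibleOfNonzero h0
    refine ⟨Module.finrank ℂ (Representation.invariants ρ), ?_⟩
    have := Representation.card_inv_mul_sum_char_eq_finrank ρ
    rw [inv_mul_eq_iff_eq_mul₀ h0] at this
    rw [this, Nat.card_eq_fintype_card]
    simp
  obtain ⟨a, b, ha, hb, rfl⟩ := hf
  obtain ⟨y, hy⟩ := key a ha
  obtain ⟨z, hz⟩ := key b hb
  refine ⟨y - z, ?_⟩
  simp only [Pi.sub_apply, Finset.sum_sub_distrib, hy, hz]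
  push_cast
  ring

/-! ### Powers of the falling factorial of the number of fixed points -/

open Polynomial in
/-- Modulo `p` the falling factorials satisfy `((X)_p) ^ k = (X)_{pk}`: both are the product of
the `X - i` with each residue `i` occurring `k` times. -/
theorem descPochhammer_pow_eq_zmod (p k : ℕ) :
    descPochhammer (ZMod p) p ^ k = descPochhammer (ZMod p) (p * k) := by
  have hprod : ∀ N, descPochhammer (ZMod p) N = ∏ i ∈ Finset.range N, (X - (i : (ZMod p)[X])) := by
    intro N
    induction N with
    | zero => simp
    | succ N ih => rw [descPochhammer_succ_right, ih, Finset.prod_range_succ]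
  induction k with
  | zero => simp
  | succ k ih =>
    rw [pow_succ, ih, hprod, hprod, hprod, mul_add, mul_one, Finset.prod_range_add]
    congr 1
    refine Finset.prod_congr rfl fun i _ => ?_
    simp

open Polynomial in
theorem exists_descPochhammer_pow_eq (p k : ℕ) :
    ∃ H : ℤ[X], descPochhammer ℤ p ^ k = descPochhammer ℤ (p * k) + (p : ℤ[X]) * H := by
  have h : (descPochhammer ℤ p ^ k - descPochhammer ℤ (p * k)).map (Int.castRingHom (ZMod p)) =
      0 := by
    rw [Polynomial.map_sub, Polynomial.map_pow, descPochhammer_map, descPochhammer_map,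
      descPochhammer_pow_eq_zmod, sub_self]
  have h2 : C (p : ℤ) ∣ descPochhammer ℤ p ^ k - descPochhammer ℤ (p * k) := by
    rw [Polynomial.C_dvd_iff_dvd_coeff]
    intro i
    have := congrArg (fun P => Polynomial.coeff P i) h
    simp only [Polynomial.coeff_map, Polynomial.coeff_zero, eq_intCast] at this
    exact (ZMod.intCast_zmod_eq_zero_iff_dvd _ _).mp this
  obtain ⟨H, hH⟩ := h2
  refine ⟨H, ?_⟩
  rw [← sub_eq_iff_eq_add', hH]
  simp

/-- The number of fixed points, as a virtual character of the symmetric group. -/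
def fixedPointChar (n : ℕ) : symmCharacterRing n :=
  ⟨fun w => (Nat.card (MulAction.fixedBy (Fin n) w) : ℂ),
    (isOrdinaryCharacter_card_fixedBy (Fin n)).mem_virtualCharacterRing⟩

open Polynomial in
/-- The value at `w` of the falling factorial `(x)_j` of the number of fixed points `x` is the
number of injections of a `j`-element set into the fixed points of `w`. -/
theorem aeval_descPochhammer_fixedPointChar_apply (n j : ℕ) (w : Equiv.Perm (Fin n)) :
    (aeval (fixedPointChar n) (descPochhammer ℤ j)).1 w =
      (Nat.card (MulAction.fixedBy (Fin n) w)).descFactorial j := by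
  have h : (aeval (fixedPointChar n) (descPochhammer ℤ j)).1 w =
      aeval ((Nat.card (MulAction.fixedBy (Fin n) w) : ℂ)) (descPochhammer ℤ j) := by
    let φ : symmCharacterRing n →+* ℂ :=
      (Pi.evalRingHom (fun _ : Equiv.Perm (Fin n) => ℂ) w).comp (Subring.subtype _)
    have := Polynomial.hom_eval₂ (descPochhammer ℤ j) (algebraMap ℤ _) φ (fixedPointChar n)
    rw [Polynomial.aeval_def, Polynomial.aeval_def]
    change φ _ = _
    rw [this]
    congr 1
  rw [h, ← descPochhammer_eval_eq_descFactorial, Polynomial.aeval_def, Polynomial.eval₂_eq_eval_map,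
    descPochhammer_map]

open Polynomial in
theorem aeval_descPochhammer_fixedPointChar_eq_zero {n j : ℕ} (h : n < j) :
    aeval (fixedPointChar n) (descPochhammer ℤ j) = 0 := by
  apply Subtype.ext
  funext w
  rw [aeval_descPochhammer_fixedPointChar_apply, Nat.descFactorial_eq_zero_iff_lt.mpr]
  · simp
  · refine lt_of_le_of_lt ?_ h
    simpa [Fintype.card_subtype] using Nat.card_le_card_of_injective _
      (Subtype.val_injective (p := fun x => x ∈ MulAction.fixedBy (Fin n) w))

open Polynomial in
/-- The average of `(x)_j` is `1` for `j ≤ n`, because the symmetric group acts transitively on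
injective `j`-tuples. -/
theorem sum_aeval_descPochhammer_fixedPointChar {n j : ℕ} (h : j ≤ n) :
    ∑ w, (aeval (fixedPointChar n) (descPochhammer ℤ j)).1 w =
      Fintype.card (Equiv.Perm (Fin n)) := by
  classical
  have hB := MulAction.sum_card_fixedBy_eq_card_orbits_mul_card_group
    (Equiv.Perm (Fin n)) (Fin j ↪ Fin n)
  have htr : MulAction.IsPretransitive (Equiv.Perm (Fin n)) (Fin j ↪ Fin n) :=
    Equiv.Perm.isMultiplyPretransitive (Fin n) j
  have : Nonempty (Fin j ↪ Fin n) := ⟨Fin.castLEEmb h⟩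
  have h1 : Fintype.card (Quotient (MulAction.orbitRel (Equiv.Perm (Fin n)) (Fin j ↪ Fin n))) = 1 :=
    by
    rw [Fintype.card_eq_one_iff_nonempty_unique]
    have := (MulAction.pretransitive_iff_unique_quotient_of_nonempty
      (Equiv.Perm (Fin n)) (Fin j ↪ Fin n)).mp htr
    exact this
  rw [h1, one_mul] at hB
  rw [← hB]
  push_cast
  refine Finset.sum_congr rfl fun w _ => ?_
  rw [aeval_descPochhammer_fixedPointChar_apply]
  congr 1
  rw [Nat.card_eq_fintype_card, ← Fintype.card_fin j, ← Fintype.card_embedding_eq,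
    Fintype.card_fin]
  refine Fintype.card_congr
    { toFun := fun e => ⟨⟨fun i => (e i).1, fun a b hab => e.injective (Subtype.ext hab)⟩, ?_⟩
      invFun := fun e => ⟨fun i => ⟨e.1 i, ?_⟩, fun a b hab => ?_⟩
      left_inv := fun e => rfl
      right_inv := fun e => rfl }
  · ext i
    exact congrArg Fin.val (e i).2
  · have := DFunLike.congr_fun e.2 i
    simpa using this
  · simpa using hab

/-! ### Colourings and Young permutation characters -/

/-- The content of a colouring `c`: the number of points of each colour. -/
def colorContent {α C : Type} (c : α → C) (i : C) : ℕ := Nat.card {x // c x = i}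

/-- The colourings of content `a` that are constant on the cycles of `w`. -/
def invariantColorings {α C : Type} (w : Equiv.Perm α) (a : C → ℕ) : Set (α → C) :=
  {c | c ∘ w = c ∧ colorContent c = a}

theorem colorContent_comp_perm {α C : Type} (c : α → C) (w : Equiv.Perm α) :
    colorContent (c ∘ w) = colorContent c := by
  funext i
  exact Nat.card_congr (w.subtypeEquiv fun x => Iff.rfl)

theorem colorContent_comp_injective {α C C' : Type} (c : α → C) {e : C → C'}
    (he : Function.Injective e) (i : C) : colorContent (e ∘ c) (e i) = colorContent c i :=
  Nat.card_congr (Equiv.subtypeEquivRight fun _ => he.eq_iff)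

theorem colorContent_eq_zero_iff {α C : Type} [Finite α] (c : α → C) (i : C) :
    colorContent c i = 0 ↔ i ∉ Set.range c := by
  rw [colorContent, Finite.card_eq_zero_iff, isEmpty_subtype]
  simp

theorem sum_colorContent {α C : Type} [Finite α] [Fintype C] (c : α → C) :
    ∑ i, colorContent c i = Nat.card α := by
  have := Fintype.ofFinite α
  rw [← Nat.card_congr (Equiv.sigmaFiberEquiv c), Nat.card_sigma]
  rfl

/-- The content of a colouring `f ∘ c` sums the content of `c` over the fibres of `f`. -/
theorem colorContent_comp {α C C' : Type} [Finite α] [Fintype C] [DecidableEq C'] (c : α → C)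
    (f : C → C') (j : C') :
    colorContent (f ∘ c) j = ∑ i with f i = j, colorContent c i := by
  have := Fintype.ofFinite α
  classical
  simp only [colorContent, Nat.card_eq_fintype_card, Fintype.card_subtype]
  rw [Finset.card_eq_sum_card_fiberwise (f := c) (t := Finset.univ.filter fun i => f i = j)]
  · refine Finset.sum_congr rfl fun i hi => congrArg _ ?_
    ext x
    simp only [Finset.mem_filter, Finset.mem_univ, true_and] at hi ⊢
    constructor
    · exact fun h => h.2
    · rintro rfl
      exact ⟨hi, rfl⟩
  · intro x hx
    simpa using hx

/-- The permutation character of the symmetric group on the colourings of content `a`. For a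
composition `a` of `n` this is the character induced from the trivial character of the Young
subgroup of type `a`. -/
def youngChar (n : ℕ) {C : Type} [Finite C] (a : C → ℕ) : symmCharacterRing n :=
  ⟨fun w => (Nat.card (invariantColorings w a) : ℂ), by
    let _ : MulAction (Equiv.Perm (Fin n)) {c : Fin n → C // colorContent c = a} :=
      { smul := fun g c => ⟨c.1 ∘ (g⁻¹ : Equiv.Perm (Fin n)), by
          rw [colorContent_comp_perm, c.2]⟩
        one_smul := fun c => rfl
        mul_smul := fun g h c => Subtype.ext (by
          change c.1 ∘ ((g * h)⁻¹ : Equiv.Perm (Fin n)) = (c.1 ∘ _) ∘ _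
          rw [mul_inv_rev]
          rfl) }
    have h := isOrdinaryCharacter_card_fixedBy (G := Equiv.Perm (Fin n))
      {c : Fin n → C // colorContent c = a}
    convert h.mem_virtualCharacterRing using 2
    next w =>
    refine congrArg Nat.cast (Nat.card_congr
      { toFun := fun c => ⟨⟨c.1, c.2.2⟩, Subtype.ext ?_⟩
        invFun := fun c => ⟨c.1.1, ?_, c.1.2⟩
        left_inv := fun c => rfl
        right_inv := fun c => rfl })
    · change c.1 ∘ (w⁻¹ : Equiv.Perm (Fin n)) = c.1
      conv_lhs => rw [← c.2.1]
      funext x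
      simp
    · have hc : c.1.1 ∘ (w⁻¹ : Equiv.Perm (Fin n)) = c.1.1 := congrArg Subtype.val c.2
      conv_lhs => rw [← hc]
      funext x
      simp⟩

theorem youngChar_apply {n : ℕ} {C : Type} [Finite C] (a : C → ℕ) (w : Equiv.Perm (Fin n)) :
    (youngChar n a).1 w = (Nat.card (invariantColorings w a) : ℂ) := rfl

/-- Colours of content zero may be dropped, and colours may be renamed. -/
theorem card_invariantColorings_comp_embedding {α C C' : Type} [Finite α] (ι : C ↪ C') (b : C' → ℕ)
    (hb : ∀ j ∉ Set.range ι, b j = 0) (w : Equiv.Perm α) :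
    Nat.card (invariantColorings w (b ∘ ι)) = Nat.card (invariantColorings w b) := by
  refine Nat.card_congr (Equiv.ofBijective (fun c => ⟨ι ∘ c.1, ?_, ?_⟩) ⟨?_, ?_⟩)
  · rw [Function.comp_assoc, c.2.1]
  · funext j
    by_cases hj : j ∈ Set.range ι
    · obtain ⟨i, rfl⟩ := hj
      rw [colorContent_comp_injective _ ι.injective, c.2.2, Function.comp]
    · rw [hb j hj, colorContent_eq_zero_iff]
      rintro ⟨x, rfl⟩
      exact hj ⟨_, rfl⟩
  · intro c d h
    refine Subtype.ext (funext fun x => ι.injective ?_)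
    exact congrFun (congrArg Subtype.val h) x
  · rintro ⟨d, hd, hd'⟩
    have hr : ∀ x, ∃ i, ι i = d x := by
      intro x
      by_contra hx
      have h0 := hb (d x) hx
      rw [← hd', colorContent_eq_zero_iff] at h0
      exact h0 ⟨x, rfl⟩
    choose c hc using hr
    obtain rfl : ι ∘ c = d := funext hc
    refine ⟨⟨c, funext fun x => ι.injective (congrFun hd x), funext fun i => ?_⟩, rfl⟩
    rw [← hd', Function.comp, colorContent_comp_injective _ ι.injective]

theorem youngChar_comp_embedding {n : ℕ} {C C' : Type} [Finite C] [Finite C'] (ι : C ↪ C')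
    (b : C' → ℕ) (hb : ∀ j ∉ Set.range ι, b j = 0) : youngChar n (b ∘ ι) = youngChar n b := by
  refine Subtype.ext (funext fun w => ?_)
  rw [youngChar_apply, youngChar_apply, card_invariantColorings_comp_embedding ι b hb]

theorem youngChar_comp_equiv {n : ℕ} {C C' : Type} [Finite C] [Finite C'] (e : C ≃ C')
    (b : C' → ℕ) : youngChar n (b ∘ e) = youngChar n b :=
  youngChar_comp_embedding e.toEmbedding b (fun j hj => (hj ⟨e.symm j, by simp⟩).elim)

/-- The contents on the product of the colour sets that have prescribed marginals `a j`. They are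
presented as the contents of actual colourings, so that their total is automatically correct. -/
def marginalContents (n : ℕ) {ι : Type} {C : ι → Type} (a : ∀ j, C j → ℕ) :
    Set ((∀ j, C j) → ℕ) :=
  colorContent '' {c : Fin n → ∀ j, C j | ∀ j, colorContent (fun x => c x j) = a j}

theorem finite_marginalContents (n : ℕ) {ι : Type} [Finite ι] {C : ι → Type} [∀ j, Finite (C j)]
    (a : ∀ j, C j → ℕ) : (marginalContents n a).Finite :=
  (Set.toFinite _).image _

/-- Mackey's formula for a product of Young characters. -/
theorem prod_youngChar {n : ℕ} {ι : Type} [Fintype ι] {C : ι → Type} [∀ j, Finite (C j)]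
    (a : ∀ j, C j → ℕ) :
    ∏ j, youngChar n (a j) =
      ∑ A ∈ (finite_marginalContents n a).toFinset, youngChar n A := by
  classical
  refine Subtype.ext (funext fun w => ?_)
  let φ : symmCharacterRing n →+* ℂ :=
    (Pi.evalRingHom (fun _ : Equiv.Perm (Fin n) => ℂ) w).comp (Subring.subtype _)
  change φ _ = φ _
  rw [map_prod, map_sum]
  change ∏ j, ((Nat.card (invariantColorings w (a j)) : ℕ) : ℂ) =
    ∑ A ∈ _, ((Nat.card (invariantColorings w A) : ℕ) : ℂ)
  rw [← Nat.cast_prod, ← Nat.cast_sum, ← Nat.card_pi]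
  congr 1
  let T : Set (Fin n → ∀ j, C j) := {c | c ∘ w = c ∧ ∀ j, colorContent (fun x => c x j) = a j}
  have e : (∀ j, invariantColorings w (a j)) ≃ T :=
    { toFun := fun c => ⟨fun x j => (c j).1 x, funext fun x => funext fun j =>
        congrFun (c j).2.1 x, fun j => (c j).2.2⟩
      invFun := fun c j => ⟨fun x => c.1 x j, funext fun x => congrFun (congrFun c.2.1 x) j,
        c.2.2 j⟩
      left_inv := fun c => rfl
      right_inv := fun c => rfl }
  have hT : T.Finite := Set.toFinite _
  rw [Nat.card_congr e, Nat.card_coe_set_eq, Set.ncard_eq_toFinset_card T hT,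
    Finset.card_eq_sum_card_fiberwise (f := colorContent)
      (t := (finite_marginalContents n a).toFinset)]
  · refine Finset.sum_congr rfl fun A hA => ?_
    rw [Nat.card_coe_set_eq, Set.ncard_eq_toFinset_card _ (Set.toFinite _)]
    congr 1
    ext c
    simp only [Finset.mem_filter, Set.Finite.mem_toFinset] at hA ⊢
    constructor
    · exact fun h => ⟨h.1.1, h.2⟩
    · intro h
      refine ⟨⟨h.1, ?_⟩, h.2⟩
      obtain ⟨d, hd, rfl⟩ := hA
      -- the marginals of a content determine the contents of the components
      intro j
      have : Fintype (∀ j, C j) := Fintype.ofFinite _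
      rw [← hd j]
      funext i
      have h1 := colorContent_comp c (fun s : ∀ j, C j => s j) i
      have h2 := colorContent_comp d (fun s : ∀ j, C j => s j) i
      rw [h.2] at h1
      exact h1.trans h2.symm
  · intro c hc
    simp only [Set.Finite.coe_toFinset] at hc ⊢
    exact ⟨c, hc.2, rfl⟩

/-! ### Products of `p`-singular Young characters -/

/-- If a `p`-group acts without fixed points on a finite set, then the sum over this set of an
invariant function is divisible by `p`. -/
theorem IsPGroup.exists_sum_eq_nsmul {p : ℕ} [Fact p.Prime] {P X M : Type*} [Group P]
    (hP : IsPGroup p P) [MulAction P X] [AddCommMonoid M] (s : Finset X)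
    (hs : ∀ (g : P), ∀ x ∈ s, g • x ∈ s) (hfix : ∀ x ∈ s, ∃ g : P, g • x ≠ x) (F : X → M)
    (hF : ∀ (g : P), ∀ x ∈ s, F (g • x) = F x) : ∃ m, ∑ x ∈ s, F x = p • m := by
  classical
  have hdvd : ∀ v, p ∣ (s.filter fun x => F x = v).card := by
    intro v
    let Y : SubMulAction P X :=
      { carrier := {x | x ∈ s ∧ F x = v}
        smul_mem' := fun g x hx => ⟨hs g x hx.1, (hF g x hx.1).trans hx.2⟩ }
    have hY : (Y : Set X) = ↑(s.filter fun x => F x = v) := by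
      simp only [Finset.coe_filter]
      rfl
    have : Finite Y := Set.Finite.to_subtype (s := (Y : Set X)) (by
      rw [hY]
      exact Finset.finite_toSet _)
    have h1 := hP.card_modEq_card_fixedPoints Y
    have h2 : IsEmpty (MulAction.fixedPoints P Y) := by
      refine ⟨fun ⟨y, hy⟩ => ?_⟩
      obtain ⟨g, hg⟩ := hfix y.1 y.2.1
      exact hg (congrArg Subtype.val (hy g))
    have h3 : Nat.card Y = (s.filter fun x => F x = v).card := by
      rw [← Set.ncard_coe_finset, ← hY]
      exact Nat.card_coe_set_eq _
    rw [h3, Nat.card_of_isEmpty (α := MulAction.fixedPoints P Y)] at h1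
    exact (Nat.modEq_zero_iff_dvd).mp h1
  choose k hk using hdvd
  refine ⟨∑ v ∈ s.image F, k v • v, ?_⟩
  rw [← Finset.sum_fiberwise_of_maps_to (g := F) (t := s.image F)
    (fun x hx => Finset.mem_image_of_mem F hx), Finset.smul_sum]
  refine Finset.sum_congr rfl fun v _ => ?_
  rw [Finset.sum_congr rfl (g := fun _ => v) (by simp), Finset.sum_const, hk v, mul_smul]

/-- The action of `(ℤ/p)^ι` on a product of colour sets `ℤ/p ⊕ D j` by translations of the
summands `ℤ/p`. -/
abbrev blockTranslation (p : ℕ) {ι : Type} (D : ι → Type) :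
    MulAction (ι → Multiplicative (ZMod p)) (∀ j, ZMod p ⊕ D j) where
  smul t s := fun j => Sum.map (fun z => (t j).toAdd + z) id (s j)
  one_smul s := by
    funext j
    change Sum.map (fun z => 0 + z) id (s j) = s j
    cases s j <;> simp
  mul_smul t u s := by
    funext j
    change Sum.map (fun z => ((t j).toAdd + (u j).toAdd) + z) id (s j) =
      Sum.map (fun z => (t j).toAdd + z) id (Sum.map (fun z => (u j).toAdd + z) id (s j))
    cases s j <;> simp [add_assoc]

section BlockTranslation

attribute [local instance] blockTranslation

theorem blockTranslation_smul_apply {p : ℕ} {ι : Type} {D : ι → Type}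
    (t : ι → Multiplicative (ZMod p)) (s : ∀ j, ZMod p ⊕ D j) (j : ι) :
    (t • s) j = Sum.map (fun z => (t j).toAdd + z) id (s j) := rfl

/-- A finite set of colours that is stable under block translations and that meets the `j`-th
block for every `j` has at least `p · |ι|` elements: an orbit that meets `m` blocks has
`p ^ m ≥ p · m` elements. -/
theorem mul_card_le_of_stable {p : ℕ} [Fact p.Prime] {ι : Type} [Fintype ι] {D : ι → Type}
    (S : Finset (∀ j, ZMod p ⊕ D j))
    (hS : ∀ (t : ι → Multiplicative (ZMod p)), ∀ s ∈ S, t • s ∈ S)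
    (hblock : ∀ j, ∃ s ∈ S, ∃ z, s j = Sum.inl z) : p * Fintype.card ι ≤ S.card := by
  classical
  -- the orbit of `s` is determined by its components outside the blocks
  let σ : (∀ j, ZMod p ⊕ D j) → ∀ j, Option (D j) := fun s j => (s j).getRight?
  choose s hs z hz using hblock
  have hfib : ∀ s ∈ S, p * (Finset.univ.filter fun j => σ s j = none).card ≤
      (S.filter fun s' => σ s' = σ s).card := by
    intro s hs
    set m := (Finset.univ.filter fun j => σ s j = none).card with hm
    have hpm : p * m ≤ p ^ m := by
      cases m with
      | zero => simp
      | succ m =>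
        rw [pow_succ']
        exact Nat.mul_le_mul_left _ (Nat.lt_pow_self (Fact.out : p.Prime).one_lt)
    refine hpm.trans ?_
    have hcard : Fintype.card ({j // σ s j = none} → ZMod p) = p ^ m := by
      rw [Fintype.card_fun, ZMod.card, Fintype.card_subtype]
    rw [← hcard, ← Fintype.card_coe]
    let t : ({j // σ s j = none} → ZMod p) → ι → Multiplicative (ZMod p) :=
      fun u j => if h : σ s j = none then Multiplicative.ofAdd (u ⟨j, h⟩) else 1
    refine Fintype.card_le_of_injective (fun u => ⟨t u • s, ?_⟩) ?_
    · refine Finset.mem_filter.mpr ⟨hS _ _ hs, ?_⟩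
      funext j
      simp only [σ, blockTranslation_smul_apply]
      cases s j <;> simp
    · intro u v huv
      funext ⟨j, hj⟩
      have h := congrFun (congrArg Subtype.val huv) j
      simp only [blockTranslation_smul_apply, t, hj, dif_pos, toAdd_ofAdd] at h
      obtain ⟨y, hy⟩ : ∃ y, s j = Sum.inl y := by
        cases hsj : s j with
        | inl y => exact ⟨y, rfl⟩
        | inr d => simp [σ, hsj] at hj
      rw [hy] at h
      simpa using h
  let q : ι → ∀ j, Option (D j) := fun j => σ (s j)
  calc p * Fintype.card ι
      = ∑ r ∈ Finset.univ.image q, p * (Finset.univ.filter fun j => q j = r).card := by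
        rw [← Finset.mul_sum, ← Finset.card_univ,
          Finset.card_eq_sum_card_fiberwise (f := q) (t := Finset.univ.image q)
            (fun j hj => Finset.mem_coe.mpr (Finset.mem_image_of_mem q hj))]
    _ ≤ ∑ r ∈ Finset.univ.image q, (S.filter fun s' => σ s' = r).card := by
        refine Finset.sum_le_sum fun r hr => ?_
        obtain ⟨i, -, rfl⟩ := Finset.mem_image.mp hr
        refine le_trans (Nat.mul_le_mul_left _ (Finset.card_le_card ?_)) (hfib (s i) (hs i))
        intro j hj
        simp only [Finset.mem_filter, Finset.mem_univ, true_and] at hj ⊢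
        change q i j = none
        rw [← hj]
        simp [q, σ, hz]
    _ ≤ S.card := by
        rw [← Finset.card_biUnion]
        · exact Finset.card_le_card (by
            intro x hx
            simp only [Finset.mem_biUnion, Finset.mem_filter] at hx
            obtain ⟨_, _, h, _⟩ := hx
            exact h)
        · intro r _ r' _ hrr'
          rw [Function.onFun, Finset.disjoint_filter]
          intro x _ h h'
          exact hrr' (h.symm.trans h')

/-- A content is `p`-singular if `p` different colours have the same positive content. -/
def IsPSingular (p : ℕ) {C : Type} (a : C → ℕ) : Prop :=
  ∃ (e : ZMod p ↪ C) (v : ℕ), 0 < v ∧ ∀ z, a (e z) = v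

/-- The colours of a `p`-singular content may be renamed so that `p` colours of equal content are
the elements of a block `ℤ/p`. -/
theorem IsPSingular.exists_youngChar_eq_of_block {p n : ℕ} [NeZero p] {C : Type} [Finite C]
    {a : C → ℕ} (ha : IsPSingular p a) :
    ∃ (D : Type) (_ : Finite D) (b : ZMod p ⊕ D → ℕ) (v : ℕ), 0 < v ∧ (∀ z, b (Sum.inl z) = v) ∧
      youngChar n b = youngChar n a := by
  classical
  obtain ⟨e, v, hv, he⟩ := ha
  let ε : ZMod p ⊕ ((Set.range e)ᶜ : Set C) ≃ C :=
    (Equiv.sumCongr (Equiv.ofInjective e e.injective) (Equiv.refl _)).trans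
      (Equiv.Set.sumCompl (Set.range e))
  exact ⟨((Set.range e)ᶜ : Set C), inferInstance, a ∘ ε, v, hv, fun z => by simpa [ε] using he z,
    youngChar_comp_equiv ε a⟩

/-- The product of more than `n / p` Young characters with `p`-singular content is divisible by
`p`. -/
theorem exists_prod_youngChar_eq {p n : ℕ} [Fact p.Prime] {ι : Type} [Fintype ι]
    (hι : n < p * Fintype.card ι) {C : ι → Type} [∀ j, Finite (C j)] (a : ∀ j, C j → ℕ)
    (ha : ∀ j, IsPSingular p (a j)) :
    ∃ f : symmCharacterRing n, ∏ j, youngChar n (a j) = p • f := by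
  classical
  have : NeZero p := ⟨(Fact.out : p.Prime).ne_zero⟩
  choose D hD b v hv hb hba using fun j => (ha j).exists_youngChar_eq_of_block (n := n)
  rw [Finset.prod_congr rfl fun j _ => (hba j).symm, prod_youngChar]
  let _ : MulAction (ι → Multiplicative (ZMod p)) ((∀ j, ZMod p ⊕ D j) → ℕ) := arrowAction
  have hsmul : ∀ (t : ι → Multiplicative (ZMod p)) (A : (∀ j, ZMod p ⊕ D j) → ℕ),
      t • A = A ∘ MulAction.toPerm t⁻¹ := fun t A => rfl
  have hP : IsPGroup p (ι → Multiplicative (ZMod p)) := by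
    refine IsPGroup.of_card (n := Fintype.card ι) ?_
    simp
  have hcomp : ∀ (t : ι → Multiplicative (ZMod p)) (c : Fin n → ∀ j, ZMod p ⊕ D j),
      t • colorContent c = colorContent (MulAction.toPerm t ∘ c) := by
    intro t c
    funext i
    rw [hsmul, Function.comp, ← colorContent_comp_injective c (MulAction.toPerm t).injective]
    congr 1
    exact smul_inv_smul t i
  refine hP.exists_sum_eq_nsmul _ ?_ ?_ _ ?_
  · intro t A hA
    simp only [Set.Finite.mem_toFinset] at hA ⊢
    obtain ⟨c, hc, rfl⟩ := hA
    refine ⟨MulAction.toPerm t ∘ c, fun j => ?_, (hcomp t c).symm⟩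
    -- a translation of the colours in the block does not change the `j`-th marginal
    let τ : Equiv.Perm (ZMod p ⊕ D j) := Equiv.sumCongr (Equiv.addLeft (t j).toAdd) (Equiv.refl _)
    funext i
    have h1 := colorContent_comp_injective (fun x => c x j) τ.injective (τ.symm i)
    rw [hc j, Equiv.apply_symm_apply] at h1
    refine Eq.trans ?_ (h1.trans ?_)
    · rfl
    · rcases i with z | d
      · exact (hb j _).trans (hb j _).symm
      · rfl
  · intro A hA
    by_contra! hfix
    simp only [Set.Finite.mem_toFinset] at hA
    obtain ⟨c, hc, rfl⟩ := hA
    have hmem : ∀ s, s ∈ Finset.univ.image c ↔ colorContent c s ≠ 0 := by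
      intro s
      rw [Ne, colorContent_eq_zero_iff]
      simp
    have h := mul_card_le_of_stable (p := p) (Finset.univ.image c) ?_ ?_
    · have := Finset.card_image_le (s := Finset.univ) (f := c)
      rw [Finset.card_univ, Fintype.card_fin] at this
      omega
    · intro t s hs
      rw [hmem] at hs ⊢
      have := congrFun (hfix t) (t • s)
      rw [hsmul] at this
      rw [← this]
      simpa using hs
    · intro j
      have h0 : colorContent (fun x => c x j) (Sum.inl 0) ≠ 0 := by
        rw [hc j, hb j]
        exact (hv j).ne'
      rw [Ne, colorContent_eq_zero_iff, not_not] at h0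
      obtain ⟨x, hx⟩ := h0
      exact ⟨c x, Finset.mem_image_of_mem c (Finset.mem_univ x), 0, hx⟩
  · intro t A _
    rw [hsmul]
    exact youngChar_comp_equiv (MulAction.toPerm t⁻¹) A

end BlockTranslation

/-! ### Colourings by cycles and conjugacy -/

/-- The colour classes of `c` are exactly the cycles of `w`, fixed points included. -/
def IsCycleColoring {α C : Type} (w : Equiv.Perm α) (c : α → C) : Prop :=
  ∀ x y, c x = c y ↔ w.SameCycle x y

theorem isCycleColoring_mk {α : Type} (w : Equiv.Perm α) :
    IsCycleColoring w (Quotient.mk (Equiv.Perm.SameCycle.setoid w)) :=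
  fun _ _ => Quotient.eq

theorem IsCycleColoring.comp_eq {α C : Type} {w : Equiv.Perm α} {c : α → C}
    (h : IsCycleColoring w c) : c ∘ w = c :=
  funext fun x => (h _ _).mpr (Equiv.Perm.sameCycle_apply_left.mpr (Equiv.Perm.SameCycle.refl w x))

theorem apply_eq_of_sameCycle {α D : Type} {w : Equiv.Perm α} {d : α → D} (hd : d ∘ w = d)
    {x y : α} (h : w.SameCycle x y) : d x = d y := by
  obtain ⟨i, rfl⟩ := h
  have key : ∀ (k : ℕ) (z : α), d ((w ^ k) z) = d z := by
    intro k
    induction k with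
    | zero => simp
    | succ k ih =>
      intro z
      rw [pow_succ, Equiv.Perm.mul_apply, ih]
      exact congrFun hd z
  rcases i with k | k
  · simpa using (key k x).symm
  · rw [zpow_negSucc]
    conv_lhs => rw [← (w ^ (k + 1)).apply_symm_apply x]
    exact key _ _

/-- Every partition of a finite set into colour classes is the partition into cycles of some
permutation. -/
theorem exists_isCycleColoring {α C : Type} [Finite α] (c : α → C) :
    ∃ w : Equiv.Perm α, IsCycleColoring w c := by
  choose f hf _ using fun i : C =>
    Set.Countable.exists_cycleOn (Set.to_countable (Set.univ : Set {x // c x = i}))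
  let W : Equiv.Perm (Σ i, {x // c x = i}) := Equiv.sigmaCongrRight f
  let E := Equiv.sigmaFiberEquiv c
  have hW : ∀ (i : C) (x : {x // c x = i}), (E.symm.trans (W.trans E)) x.1 = (f i x).1 := by
    rintro i ⟨x, rfl⟩
    rfl
  have hcol : c ∘ (E.symm.trans (W.trans E)) = c := by
    funext x
    have := hW (c x) ⟨x, rfl⟩
    simp only [Function.comp]
    rw [this]
    exact (f (c x) ⟨x, rfl⟩).2
  refine ⟨E.symm.trans (W.trans E), fun x y => ⟨fun h => ?_, apply_eq_of_sameCycle hcol⟩⟩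
  obtain ⟨k, hk⟩ := ((hf (c x)).2 (Set.mem_univ ⟨x, rfl⟩)
    (Set.mem_univ ⟨y, h.symm⟩)).exists_nat_pow_eq
  refine ⟨k, ?_⟩
  have key : ∀ (k : ℕ) (z : {z // c z = c x}),
      ((E.symm.trans (W.trans E)) ^ k) z.1 = (((f (c x)) ^ k) z).1 := by
    intro k
    induction k with
    | zero => intro z; rfl
    | succ k ih =>
      intro z
      rw [pow_succ, Equiv.Perm.mul_apply, hW, ih, pow_succ, Equiv.Perm.mul_apply]
  rw [zpow_natCast, key k ⟨x, rfl⟩, hk]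

theorem IsCycleColoring.isCycleOn {α C : Type} {w : Equiv.Perm α} {c : α → C}
    (h : IsCycleColoring w c) (i : C) : w.IsCycleOn {x | c x = i} := by
  have h1 : ∀ x, c (w x) = c x := congrFun h.comp_eq
  refine ⟨⟨fun x hx => (h1 x).trans hx, w.injective.injOn, fun y hy => ⟨w⁻¹ y, ?_, by simp⟩⟩,
    fun x hx y hy => (h x y).mp (hx.trans hy.symm)⟩
  have := h1 (w⁻¹ y)
  rw [show w (w⁻¹ y) = y from w.apply_symm_apply y] at this
  exact this.symm.trans hy

/-- Permutations with the same cycle lengths are conjugate. -/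
theorem IsCycleColoring.isConj {α C : Type} [Finite α] {w w' : Equiv.Perm α} {c c' : α → C}
    (h : IsCycleColoring w c) (h' : IsCycleColoring w' c') (hc : colorContent c = colorContent c') :
    IsConj w w' := by
  classical
  have := Fintype.ofFinite α
  -- Base points `r i`, `r' i` in the cycles of colour `i`; the conjugating permutation sends
  -- `w ^ k (r i)` to `w' ^ k (r' i)`, which is well defined as the two cycles have the same length.
  have hr : ∀ i : Set.range c, ∃ r r' : α, c r = i ∧ c' r' = i := by
    rintro ⟨_, x, rfl⟩
    have h0 : colorContent c (c x) ≠ 0 := by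
      rw [Ne, colorContent_eq_zero_iff, not_not]
      exact ⟨x, rfl⟩
    rw [hc, Ne, colorContent_eq_zero_iff, not_not] at h0
    obtain ⟨x', hx'⟩ := h0
    exact ⟨x, x', rfl, hx'⟩
  choose r r' hr hr' using hr
  let q : α → Set.range c := fun x => ⟨c x, x, rfl⟩
  have hk : ∀ x, ∃ k : ℤ, (w ^ k) (r (q x)) = x := fun x => (h _ _).mp (hr (q x))
  choose k hk using hk
  let σ : α → α := fun x => (w' ^ k x) (r' (q x))
  have hcyc : ∀ (i : Set.range c) (m n : ℤ),
      (w ^ m) (r i) = (w ^ n) (r i) ↔ (w' ^ m) (r' i) = (w' ^ n) (r' i) := by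
    intro i m n
    have e1 := (h.isCycleOn i.1)
    have e2 := (h'.isCycleOn i.1)
    rw [← Set.coe_toFinset {x | c x = i.1}] at e1
    rw [← Set.coe_toFinset {x | c' x = i.1}] at e2
    rw [e1.zpow_apply_eq_zpow_apply (by simpa using hr i),
      e2.zpow_apply_eq_zpow_apply (by simpa using hr' i)]
    have hcard := congrFun hc i.1
    rw [colorContent, colorContent, Nat.card_eq_fintype_card, Nat.card_eq_fintype_card,
      Fintype.card_subtype, Fintype.card_subtype] at hcard
    simp [hcard]
  have hcw : ∀ x (m : ℤ), c ((w ^ m) x) = c x := fun x m =>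
    ((h _ _).mpr ⟨m, rfl⟩).symm
  have hcw' : ∀ x (m : ℤ), c' ((w' ^ m) x) = c' x := fun x m =>
    ((h' _ _).mpr ⟨m, rfl⟩).symm
  have hσ : ∀ (i : Set.range c) (m : ℤ), σ ((w ^ m) (r i)) = (w' ^ m) (r' i) := by
    intro i m
    have hq : q ((w ^ m) (r i)) = i := Subtype.ext ((hcw _ _).trans (hr i))
    have := hk ((w ^ m) (r i))
    rw [hq, hcyc] at this
    change (w' ^ k _) (r' (q _)) = _
    rw [hq, this]
  have hinj : Function.Injective σ := by
    intro x y hxy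
    have hq : q x = q y := by
      apply Subtype.ext
      have := congrArg c' hxy
      simp only [σ, hcw', hr'] at this
      exact this
    rw [← hk x, ← hk y, hq, hcyc]
    have : (w' ^ k x) (r' (q x)) = (w' ^ k y) (r' (q y)) := hxy
    rwa [hq] at this
  rw [isConj_iff]
  refine ⟨Equiv.ofBijective σ hinj.bijective_of_finite, ?_⟩
  rw [mul_inv_eq_iff_eq_mul]
  ext x
  change σ (w x) = w' (σ x)
  have h1 : w x = (w ^ (k x + 1)) (r (q x)) := by
    rw [add_comm, zpow_add, zpow_one, Equiv.Perm.mul_apply, hk]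
  rw [h1, hσ, add_comm, zpow_add, zpow_one, Equiv.Perm.mul_apply]

/-- A colouring that is constant on the cycles of `w`, uses all its colours and has at least as
many colours as `w` has cycles is a recolouring of the colouring by cycles. -/
theorem IsCycleColoring.exists_equiv {α C D : Type} [Finite α] [Finite C] {w : Equiv.Perm α}
    {c : α → C} (h : IsCycleColoring w c) (hc : Function.Surjective c) {d : α → D}
    (hd : d ∘ w = d) (hd' : Function.Surjective d) (hle : Nat.card C ≤ Nat.card D) :
    ∃ τ : C ≃ D, d = τ ∘ c := by
  have hτ : ∀ x, d (Function.surjInv hc (c x)) = d x := fun x =>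
    apply_eq_of_sameCycle hd ((h _ _).mp (Function.surjInv_eq hc _))
  have hs : Function.Surjective (fun i => d (Function.surjInv hc i)) := by
    intro j
    obtain ⟨x, rfl⟩ := hd' j
    exact ⟨c x, hτ x⟩
  have hb : Function.Bijective (fun i => d (Function.surjInv hc i)) :=
    hs.bijective_of_nat_card_le hle
  exact ⟨Equiv.ofBijective _ hb, funext fun x => (hτ x).symm⟩

theorem surjective_of_colorContent_ne_zero {α C : Type} [Finite α] {c : α → C}
    (h : ∀ i, colorContent c i ≠ 0) : Function.Surjective c := fun i => by
  have := h i
  rwa [Ne, colorContent_eq_zero_iff, not_not] at this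

theorem colorContent_ne_zero_of_surjective {α C : Type} [Finite α] {c : α → C}
    (h : Function.Surjective c) (i : C) : colorContent c i ≠ 0 := by
  rw [Ne, colorContent_eq_zero_iff, not_not]
  exact h i

/-- Class functions are determined by their pairings with the Young characters: with respect to
the number of cycles, the matrix of values of the Young characters is triangular. -/
theorem eq_zero_of_forall_sum_mul_youngChar {n : ℕ} {f : Equiv.Perm (Fin n) → ℂ}
    (hf : ∀ g h, f (h * g * h⁻¹) = f g)
    (h0 : ∀ (C : Type) [Finite C] (b : C → ℕ), ∑ w, f w * (youngChar n b).1 w = 0) : f = 0 := by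
  classical
  by_contra hne
  obtain ⟨w₀, hw₀⟩ := Function.ne_iff.mp hne
  let cyc : Equiv.Perm (Fin n) → ℕ := fun w => Nat.card (Quotient (Equiv.Perm.SameCycle.setoid w))
  -- a permutation outside the zeros of `f` with the largest possible number of cycles
  obtain ⟨w, hw, hmax⟩ := Finset.exists_max_image (Finset.univ.filter fun w => f w ≠ 0) cyc
    ⟨w₀, by simpa using hw₀⟩
  simp only [Finset.mem_filter, Finset.mem_univ, true_and] at hw hmax
  let c : Fin n → Quotient (Equiv.Perm.SameCycle.setoid w) := Quotient.mk _
  have hcol : IsCycleColoring w c := isCycleColoring_mk w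
  have hsurj : Function.Surjective c := Quotient.mk_surjective
  -- On the support of `f`, the Young character of the cycle type of `w` is nonzero only on the
  -- conjugacy class of `w`, where `f` is constant.
  have key : ∀ w', f w' * (youngChar n (colorContent c)).1 w' =
      f w * (if f w' = 0 then 0 else Nat.card (invariantColorings w' (colorContent c)) : ℕ) := by
    intro w'
    rw [youngChar_apply]
    by_cases hw' : f w' = 0
    · simp [hw']
    rw [if_neg hw']
    rcases isEmpty_or_nonempty (invariantColorings w' (colorContent c)) with hE | ⟨⟨d, hd, hd'⟩⟩
    · simp
    have hds : Function.Surjective d := surjective_of_colorContent_ne_zero fun i => by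
      rw [hd']
      exact colorContent_ne_zero_of_surjective hsurj i
    obtain ⟨τ, hτ⟩ := (isCycleColoring_mk w').exists_equiv Quotient.mk_surjective hd hds
      (hmax w' hw')
    have hdc : IsCycleColoring w' d := by
      intro x y
      rw [hτ]
      exact τ.injective.eq_iff.trans (isCycleColoring_mk w' x y)
    obtain ⟨g, hg⟩ := isConj_iff.mp (hcol.isConj hdc hd'.symm)
    rw [← hg, hf]
  have hsum := h0 _ (colorContent c)
  rw [Finset.sum_congr rfl fun w' _ => key w', ← Finset.mul_sum, ← Nat.cast_sum] at hsum
  rcases mul_eq_zero.mp hsum with h | h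
  · exact hw h
  · have h1 := (Finset.sum_eq_zero_iff.mp (Nat.cast_eq_zero.mp h)) w (Finset.mem_univ w)
    rw [if_neg hw, Finite.card_eq_zero_iff] at h1
    exact h1.false ⟨c, hcol.comp_eq, rfl⟩

/-- The value of a Young character at a permutation of the corresponding cycle type is the number
of permutations of the cycles that preserve their lengths. -/
theorem IsCycleColoring.card_invariantColorings {α C : Type} [Finite α] [Finite C]
    {w : Equiv.Perm α} {c : α → C} (h : IsCycleColoring w c) (hc : Function.Surjective c) :
    Nat.card (invariantColorings w (colorContent c)) =
      Nat.card {g : Equiv.Perm C // colorContent c ∘ g = colorContent c} := by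
  refine (Nat.card_congr (Equiv.ofBijective (fun g => ⟨g.1 ∘ c, ?h1, ?h2⟩) ⟨?h3, ?h4⟩)).symm
  case h1 =>
    rw [Function.comp_assoc, h.comp_eq]
  case h2 =>
    funext i
    obtain ⟨i, rfl⟩ := g.1.surjective i
    rw [colorContent_comp_injective c g.1.injective]
    exact (congrFun g.2 i).symm
  · intro g g' hg
    refine Subtype.ext (Equiv.ext fun i => ?_)
    obtain ⟨x, rfl⟩ := hc i
    exact congrFun (congrArg Subtype.val hg) x
  · rintro ⟨d, hd, hd'⟩
    have hds : Function.Surjective d := surjective_of_colorContent_ne_zero fun i => by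
      rw [hd']
      exact colorContent_ne_zero_of_surjective hc i
    obtain ⟨τ, rfl⟩ := h.exists_equiv hc hd hds le_rfl
    refine ⟨⟨τ, funext fun i => ?_⟩, rfl⟩
    rw [Function.comp, ← hd', colorContent_comp_injective c τ.injective, hd']

/-- If `w` has a `p`-regular cycle type, then the value at `w` of the corresponding Young character
is prime to `p`. -/
theorem IsCycleColoring.not_dvd_card_invariantColorings {p : ℕ} [Fact p.Prime] {α C : Type}
    [Finite α] [Finite C] {w : Equiv.Perm α} {c : α → C} (h : IsCycleColoring w c)
    (hc : Function.Surjective c) (hreg : ¬ IsPSingular p (colorContent c)) :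
    ¬ p ∣ Nat.card (invariantColorings w (colorContent c)) := by
  classical
  have := Fintype.ofFinite C
  have hp : p.Prime := Fact.out
  have : NeZero p := ⟨hp.ne_zero⟩
  rw [h.card_invariantColorings hc, Nat.card_eq_fintype_card, DomMulAct.stabilizer_card',
    Prime.dvd_finsetProd_iff hp.prime]
  rintro ⟨v, hv, hdvd⟩
  rw [hp.dvd_factorial, ← ZMod.card p] at hdvd
  obtain ⟨e⟩ := Function.Embedding.nonempty_of_card_le hdvd
  refine hreg ⟨e.trans (Function.Embedding.subtype _), v, ?_, fun z => (e z).2⟩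
  obtain ⟨i, -, rfl⟩ := Finset.mem_image.mp hv
  exact Nat.pos_of_ne_zero (colorContent_ne_zero_of_surjective hc i)

/-! ### Signed pairings of Young characters -/

/-- The sets of cells `{(i, d) | d ∈ s i}` with row sums `a` and column sums `b`, that is, the
zero-one matrices with these row and column sums. -/
def zeroOneMatrices {C D : Type} (a : C → ℕ) (b : D → ℕ) : Set (C → Finset D) :=
  {s | (∀ i, (s i).card = a i) ∧ ∀ d, Nat.card {i // d ∈ s i} = b d}

/-- The signed sum of the stabilizer of a colouring is nonzero only if the colouring is injective,
for otherwise the stabilizer contains a transposition. -/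
theorem sum_sign_stabilizer {α C : Type} [Fintype α] [DecidableEq α] (u : α → C)
    [DecidablePred fun w : Equiv.Perm α => u ∘ (w : α → α) = u]
    [Decidable (Function.Injective u)] :
    ∑ w ∈ Finset.univ.filter (fun w : Equiv.Perm α => u ∘ (w : α → α) = u),
      (Equiv.Perm.sign w : ℤ) = if Function.Injective u then 1 else 0 := by
  split_ifs with hu
  · have : (Finset.univ.filter fun w : Equiv.Perm α => u ∘ (w : α → α) = u) = {1} := by
      ext w
      simp only [Finset.mem_filter, Finset.mem_univ, true_and, Finset.mem_singleton]
      constructor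
      · exact fun h => Equiv.ext fun x => hu (congrFun h x)
      · rintro rfl
        rfl
    rw [this]
    simp
  · rw [Function.not_injective_iff] at hu
    obtain ⟨x, y, hxy, hne⟩ := hu
    have hswap : u ∘ Equiv.swap x y = u := by
      funext z
      simp only [Function.comp, Equiv.swap_apply_def]
      split_ifs with h1 h2
      · rw [h1, hxy]
      · rw [h2, hxy]
      · rfl
    -- multiplication by the transposition pairs off even and odd elements of the stabilizer
    refine Finset.sum_involution (fun w _ => w * Equiv.swap x y) ?_ ?_ ?_ ?_
    · intro w _
      simp [Equiv.Perm.sign_swap hne]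
    · intro w _ _ h
      rw [mul_eq_left, Equiv.swap_eq_one_iff] at h
      exact hne h
    · intro w hw
      simp only [Finset.mem_filter, Finset.mem_univ, true_and] at hw ⊢
      rw [Equiv.Perm.coe_mul, ← Function.comp_assoc, hw, hswap]
    · intro w _
      simp [mul_assoc]

/-- The colourings by pairs with prescribed contents of the two components. -/
def pairColorings (n : ℕ) {C D : Type} (a : C → ℕ) (b : D → ℕ) : Set (Fin n → C × D) :=
  {u | colorContent (Prod.fst ∘ u) = a ∧ colorContent (Prod.snd ∘ u) = b}

theorem sum_sign_mul_invariantColorings {n : ℕ} {C D : Type} [Finite C] [Finite D] (a : C → ℕ)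
    (b : D → ℕ) :
    ∑ w : Equiv.Perm (Fin n), (Equiv.Perm.sign w : ℤ) *
        (Nat.card (invariantColorings w a) * Nat.card (invariantColorings w b) : ℤ) =
      Nat.card {u : Fin n → C × D // u ∈ pairColorings n a b ∧ Function.Injective u} := by
  classical
  have := Fintype.ofFinite C
  have := Fintype.ofFinite D
  have hcard : ∀ w : Equiv.Perm (Fin n),
      (Nat.card (invariantColorings w a) * Nat.card (invariantColorings w b) : ℤ) =
        ∑ u : Fin n → C × D with u ∈ pairColorings n a b, if u ∘ w = u then 1 else 0 := by
    intro w
    rw [← Nat.cast_mul, ← Nat.card_prod, Finset.sum_boole, Finset.filter_filter,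
      ← Fintype.card_subtype, ← Nat.card_eq_fintype_card]
    refine congrArg Nat.cast (Nat.card_congr
      { toFun := fun c => ⟨fun x => (c.1.1 x, c.2.1 x), ⟨c.1.2.2, c.2.2.2⟩,
          funext fun x => Prod.ext (congrFun c.1.2.1 x) (congrFun c.2.2.1 x)⟩
        invFun := fun u => (⟨Prod.fst ∘ u.1, ?_, u.2.1.1⟩, ⟨Prod.snd ∘ u.1, ?_, u.2.1.2⟩)
        left_inv := fun c => rfl
        right_inv := fun u => rfl })
    · rw [Function.comp_assoc, u.2.2]
    · rw [Function.comp_assoc, u.2.2]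
  simp only [hcard, Finset.mul_sum]
  rw [Finset.sum_comm]
  rw [Finset.sum_congr rfl fun u _ => (by
    simp only [mul_ite, mul_one, mul_zero]
    rw [← Finset.sum_filter, sum_sign_stabilizer])]
  rw [Finset.sum_boole, Nat.card_eq_fintype_card, Fintype.card_subtype, Finset.filter_filter]

/-- The contents of the components of a bijection onto the set of cells of a zero-one matrix are
its row sums and column sums. -/
theorem colorContent_of_equiv_cells {α C D : Type} [Finite D] {s : C → Finset D}
    (e : α ≃ {x : C × D // x.2 ∈ s x.1}) :
    (∀ i, colorContent (fun x => (e x).1.1) i = (s i).card) ∧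
      ∀ d, colorContent (fun x => (e x).1.2) d = Nat.card {i // d ∈ s i} := by
  constructor
  · intro i
    rw [colorContent, Nat.card_congr (e.subtypeEquiv
      (q := fun y : {x : C × D // x.2 ∈ s x.1} => y.1.1 = i) fun _ => Iff.rfl),
      ← Nat.subtype_card (s i) (fun _ => Iff.rfl)]
    exact Nat.card_congr
      { toFun := fun y => ⟨y.1.1.2, by have := y.1.2; rwa [y.2] at this⟩
        invFun := fun d => ⟨⟨(i, d.1), d.2⟩, rfl⟩
        left_inv := by rintro ⟨⟨⟨_, _⟩, _⟩, rfl⟩; rfl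
        right_inv := fun d => rfl }
  · intro d
    rw [colorContent, Nat.card_congr (e.subtypeEquiv
      (q := fun y : {x : C × D // x.2 ∈ s x.1} => y.1.2 = d) fun _ => Iff.rfl)]
    exact Nat.card_congr
      { toFun := fun y => ⟨y.1.1.1, by have := y.1.2; rwa [y.2] at this⟩
        invFun := fun i => ⟨⟨(i.1, d), i.2⟩, rfl⟩
        left_inv := by rintro ⟨⟨⟨_, _⟩, _⟩, rfl⟩; rfl
        right_inv := fun d => rfl }

/-- An injective colouring by pairs is an enumeration of the cells of a zero-one matrix. -/
theorem card_injective_pairColorings {n : ℕ} {C D : Type} [Finite C] [Fintype D] (a : C → ℕ)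
    (b : D → ℕ) (hb : ∑ d, b d = n) :
    Nat.card {u : Fin n → C × D // u ∈ pairColorings n a b ∧ Function.Injective u} =
      n.factorial * Nat.card (zeroOneMatrices a b) := by
  classical
  have := Fintype.ofFinite C
  let T : Finset (Fin n → C × D) :=
    Finset.univ.filter fun u => u ∈ pairColorings n a b ∧ Function.Injective u
  let Z : Finset (C → Finset D) := Finset.univ.filter fun s => s ∈ zeroOneMatrices a b
  have hZ : Nat.card (zeroOneMatrices a b) = Z.card := by
    rw [Nat.card_eq_fintype_card, ← Fintype.card_subtype]
  have hT : Nat.card {u : Fin n → C × D // u ∈ pairColorings n a b ∧ Function.Injective u} =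
      T.card := by
    rw [Nat.card_eq_fintype_card, Fintype.card_subtype]
  let cells : (Fin n → C × D) → C → Finset D := fun u i =>
    Finset.univ.filter fun d => (i, d) ∈ Set.range u
  -- each zero-one matrix has `n` cells, and these have `n!` enumerations
  rw [hZ, hT, Finset.card_eq_sum_card_fiberwise (f := cells) (t := Z)]
  · rw [Finset.sum_congr rfl (g := fun _ => n.factorial), Finset.sum_const, smul_eq_mul, mul_comm]
    intro s hs
    simp only [Z, Finset.mem_filter, Finset.mem_univ, true_and] at hs
    have hcard : Fintype.card {x : C × D // x.2 ∈ s x.1} = n := by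
      have h1 := sum_colorContent (fun y : {x : C × D // x.2 ∈ s x.1} => y.1.2)
      have h2 := (colorContent_of_equiv_cells (Equiv.refl {x : C × D // x.2 ∈ s x.1})).2
      simp only [Equiv.refl_apply] at h2
      rw [Finset.sum_congr rfl fun d _ => (h2 d).trans (hs.2 d), hb, Nat.card_eq_fintype_card] at h1
      exact h1.symm
    have hfact : Fintype.card (Fin n ≃ {x : C × D // x.2 ∈ s x.1}) = n.factorial := by
      rw [Fintype.card_equiv (Fintype.equivOfCardEq (by rw [hcard, Fintype.card_fin])),
        Fintype.card_fin]
    rw [← hfact, ← Finset.card_univ]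
    symm
    refine Finset.card_bij (fun e _ x => (e x).1) ?_ ?_ ?_
    · intro e _
      obtain ⟨h1, h2⟩ := colorContent_of_equiv_cells e
      refine Finset.mem_filter.mpr ⟨Finset.mem_filter.mpr ⟨Finset.mem_univ _, ⟨?_, ?_⟩, ?_⟩, ?_⟩
      · exact funext fun i => (h1 i).trans (hs.1 i)
      · exact funext fun d => (h2 d).trans (hs.2 d)
      · exact Subtype.val_injective.comp e.injective
      · funext i
        ext d
        simp only [cells, Finset.mem_filter, Finset.mem_univ, true_and, Set.mem_range]
        constructor
        · rintro ⟨x, hx⟩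
          have := (e x).2
          rwa [hx] at this
        · intro hd
          exact ⟨e.symm ⟨(i, d), hd⟩, by simp⟩
    · intro e _ e' _ h
      exact Equiv.ext fun x => Subtype.ext (congrFun h x)
    · intro u hu
      simp only [T, Finset.mem_filter, Finset.mem_univ, true_and] at hu
      obtain ⟨⟨-, hinj⟩, rfl⟩ := hu
      refine ⟨Equiv.ofBijective (fun x => ⟨u x, by simp [cells]⟩) ⟨?_, ?_⟩, Finset.mem_univ _, rfl⟩
      · intro x y h
        exact hinj (congrArg Subtype.val h)
      · rintro ⟨⟨i, d⟩, h⟩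
        simp only [cells, Finset.mem_filter, Finset.mem_univ, true_and] at h
        obtain ⟨x, hx⟩ := h
        exact ⟨x, Subtype.ext hx⟩
  · intro u hu
    simp only [T, Finset.coe_filter, Finset.mem_univ, true_and, Set.mem_ofPred_eq] at hu
    obtain ⟨⟨ha, hb⟩, hinj⟩ := hu
    let e : Fin n ≃ {x : C × D // x.2 ∈ cells u x.1} :=
      Equiv.ofBijective (fun x => ⟨u x, by simp [cells]⟩)
        ⟨fun x y h => hinj (congrArg Subtype.val h), by
          rintro ⟨⟨i, d⟩, h⟩
          simp only [cells, Finset.mem_filter, Finset.mem_univ, true_and] at h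
          obtain ⟨x, hx⟩ := h
          exact ⟨x, Subtype.ext hx⟩⟩
    obtain ⟨h1, h2⟩ := colorContent_of_equiv_cells e
    simp only [Z, Finset.coe_filter, Finset.mem_univ, true_and, Set.mem_ofPred_eq]
    exact ⟨fun i => (h1 i).symm.trans (congrFun ha i), fun d => (h2 d).symm.trans (congrFun hb d)⟩

/-- The coefficients of a product of elementary symmetric polynomials count zero-one matrices. -/
theorem coeff_prod_esymm {C σ : Type} [Fintype C] [Fintype σ] (a : C → ℕ) (b : σ →₀ ℕ) :
    MvPolynomial.coeff b (∏ i, MvPolynomial.esymm σ ℤ (a i)) =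
      Nat.card (zeroOneMatrices a (b : σ → ℕ)) := by
  classical
  simp only [MvPolynomial.esymm]
  rw [Finset.prod_univ_sum, MvPolynomial.coeff_sum]
  have h : ∀ s : C → Finset σ, MvPolynomial.coeff b
      (∏ i, ∏ d ∈ s i, (MvPolynomial.X d : MvPolynomial σ ℤ)) =
      if ∀ d, Nat.card {i // d ∈ s i} = b d then 1 else 0 := by
    intro s
    have : ∏ i, ∏ d ∈ s i, (MvPolynomial.X d : MvPolynomial σ ℤ) =
        MvPolynomial.monomial (∑ i, ∑ d ∈ s i, Finsupp.single d 1) 1 := by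
      rw [MvPolynomial.monomial_sum_one]
      refine Finset.prod_congr rfl fun i _ => ?_
      rw [MvPolynomial.monomial_sum_one]
      rfl
    rw [this, MvPolynomial.coeff_monomial]
    simp only [DFunLike.ext_iff]
    refine if_congr (forall_congr' fun d => ?_) rfl rfl
    rw [Nat.card_eq_fintype_card, Fintype.card_subtype]
    simp [Finsupp.finsetSum_apply, Finsupp.single_apply]
  rw [Finset.sum_congr rfl fun s _ => h s, Finset.sum_boole]
  rw [Nat.card_eq_fintype_card, ← Set.toFinset_card]
  congr 2
  ext s
  simp only [Finset.mem_filter, Fintype.mem_piFinset, Finset.mem_powersetCard, Set.mem_toFinset,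
    Finset.subset_univ, true_and]
  rfl

/-! ### Young characters span the character ring -/

/-- The Young character attached to a partition of `n`; the colours are the parts. -/
def partitionChar {n : ℕ} (l : n.Partition) : symmCharacterRing n :=
  youngChar n (fun x : l.parts.ToType => x.1)

theorem youngChar_eq_zero {n : ℕ} {C : Type} [Finite C] (a : C → ℕ)
    (h : ∀ c : Fin n → C, colorContent c ≠ a) : youngChar n a = 0 := by
  refine Subtype.ext (funext fun w => ?_)
  rw [youngChar_apply, Nat.cast_eq_zero.mpr]
  · rfl
  · rw [Finite.card_eq_zero_iff]
    exact ⟨fun c => h c.1 c.2.2⟩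

/-- Every Young character is zero or the Young character of a partition. -/
theorem youngChar_eq_zero_or_eq_partitionChar {n : ℕ} {C : Type} [Finite C] (a : C → ℕ) :
    youngChar n a = 0 ∨ ∃ l : n.Partition, youngChar n a = partitionChar l := by
  classical
  have := Fintype.ofFinite C
  by_cases h : ∀ c : Fin n → C, colorContent c ≠ a
  · exact Or.inl (youngChar_eq_zero a h)
  push Not at h
  obtain ⟨c, rfl⟩ := h
  set a := colorContent c
  let S : Multiset C := (Finset.univ.filter fun i => a i ≠ 0).val
  let l : n.Partition :=
    { parts := S.map a
      parts_pos := by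
        intro i hi
        obtain ⟨j, hj, rfl⟩ := Multiset.mem_map.mp hi
        have : j ∈ Finset.univ.filter fun i => a i ≠ 0 := hj
        exact Nat.pos_of_ne_zero (Finset.mem_filter.mp this).2
      parts_sum := by
        change ∑ i ∈ Finset.univ.filter (fun i => a i ≠ 0), a i = n
        rw [Finset.sum_filter_ne_zero, sum_colorContent, Nat.card_eq_fintype_card,
          Fintype.card_fin] }
  let e : l.parts.ToType ≃ S.ToType := (Multiset.mapEquiv S a).symm
  have he : ∀ x, a (e x).1 = x.1 := by
    intro x
    have := Multiset.mapEquiv_apply S a (e x)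
    rw [← this]
    simp [e]
  have hinj : Function.Injective (fun x : S.ToType => x.1) := by
    rintro ⟨x, i⟩ ⟨y, j⟩ (rfl : x = y)
    have h1 : S.count x ≤ 1 := Multiset.nodup_iff_count_le_one.mp (Finset.nodup _) x
    have : i = j := Fin.ext (by omega)
    rw [this]
  let ε : l.parts.ToType ↪ C := ⟨fun x => (e x).1, hinj.comp e.injective⟩
  refine Or.inr ⟨l, ?_⟩
  rw [partitionChar, ← youngChar_comp_embedding ε a]
  · congr 1
    funext x
    exact he x
  · intro j hj
    by_contra hj0
    refine hj ?_
    have hjS : j ∈ S := by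
      change j ∈ Finset.univ.filter fun i => a i ≠ 0
      simpa using hj0
    exact ⟨e.symm (S.mkToType j ⟨0, Multiset.count_pos.mpr hjS⟩),
      congrArg Sigma.fst (e.apply_symm_apply _)⟩

theorem youngChar_mem_span {n : ℕ} {C : Type} [Finite C] (a : C → ℕ) :
    youngChar n a ∈ Submodule.span ℤ (Set.range (partitionChar (n := n))) := by
  rcases youngChar_eq_zero_or_eq_partitionChar (n := n) a with h | ⟨l, h⟩
  · rw [h]
    exact zero_mem _
  · rw [h]
    exact Submodule.subset_span ⟨l, rfl⟩

/-- The sign character. -/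
def signChar (n : ℕ) : symmCharacterRing n :=
  ⟨_, (isOrdinaryCharacter_sign (Fin n)).mem_virtualCharacterRing⟩

theorem signChar_apply {n : ℕ} (w : Equiv.Perm (Fin n)) :
    (signChar n).1 w = ((Equiv.Perm.sign w : ℤ) : ℂ) := rfl

/-- A virtual character vanishes if it is orthogonal to the Young characters with
colours `Fin n`: no other colour sets are needed, as at most `n` colours are ever used. -/
theorem symmCharacterRing.eq_zero_of_forall_sum {n : ℕ} {f : symmCharacterRing n}
    (h0 : ∀ b : Fin n → ℕ, ∑ i, b i = n → ∑ w, f.1 w * (youngChar n b).1 w = 0) : f = 0 := by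
  classical
  refine Subtype.ext (eq_zero_of_forall_sum_mul_youngChar
    (virtualCharacterRing.apply_conj f.2 · ·) fun C _ b => ?_)
  by_cases h : ∀ c : Fin n → C, colorContent c ≠ b
  · rw [youngChar_eq_zero b h]
    simp
  push Not at h
  obtain ⟨c, rfl⟩ := h
  have hcard : Nat.card (Set.range c) ≤ Nat.card (Fin n) :=
    Nat.card_le_card_of_surjective _ Set.rangeFactorization_surjective
  obtain ⟨e⟩ : Nonempty (Set.range c ↪ Fin n) := by
    have := Fintype.ofFinite (Set.range c)
    rw [Nat.card_eq_fintype_card, Nat.card_eq_fintype_card] at hcard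
    exact Function.Embedding.nonempty_of_card_le hcard
  let c' : Fin n → Fin n := e ∘ Set.rangeFactorization c
  have h1 : youngChar n (colorContent c) = youngChar n (colorContent c ∘ Subtype.val) :=
    (youngChar_comp_embedding (Function.Embedding.subtype fun i => i ∈ Set.range c) _ fun j hj => by
      rw [colorContent_eq_zero_iff]
      exact fun hj' => hj ⟨⟨j, hj'⟩, rfl⟩).symm
  have h2 : youngChar n (colorContent c') = youngChar n (colorContent c' ∘ e) :=
    (youngChar_comp_embedding e _ fun j hj => by
      rw [colorContent_eq_zero_iff]
      rintro ⟨x, rfl⟩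
      exact hj ⟨_, rfl⟩).symm
  have h3 : colorContent c ∘ Subtype.val = colorContent c' ∘ e := by
    funext i
    exact (colorContent_comp_injective (Set.rangeFactorization c) Subtype.val_injective i).trans
      (colorContent_comp_injective (Set.rangeFactorization c) e.injective i).symm
  rw [h1, h3, ← h2]
  refine h0 _ ?_
  rw [sum_colorContent, Nat.card_eq_fintype_card, Fintype.card_fin]

open MvPolynomial in
/-- The Young characters of partitions span the character ring over the integers. The signed
pairings of a virtual character with the Young characters are the coefficients of a
symmetric polynomial with integer coefficients. The expression of this polynomial in the elementary
symmetric polynomials expresses the character in the Young characters. -/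
theorem mem_span_partitionChar {n : ℕ} (f : symmCharacterRing n) :
    f ∈ Submodule.span ℤ (Set.range (partitionChar (n := n))) := by
  classical
  have hz : ∀ b : Fin n → ℕ, ∃ z : ℤ, ∑ w, (signChar n * f).1 w * (youngChar n b).1 w =
      n.factorial * z := by
    intro b
    obtain ⟨z, hz⟩ := virtualCharacterRing.exists_sum_eq (signChar n * f * youngChar n b).2
    rw [Fintype.card_perm, Fintype.card_fin] at hz
    exact ⟨z, hz⟩
  choose z hz using hz
  have hn : (n.factorial : ℂ) ≠ 0 := by exact_mod_cast n.factorial_ne_zero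
  have hzperm : ∀ (e : Equiv.Perm (Fin n)) (b : Fin n → ℕ), z (b ∘ e) = z b := by
    intro e b
    have h1 := hz (b ∘ e)
    rw [youngChar_comp_equiv, hz b] at h1
    exact_mod_cast (mul_left_cancel₀ hn h1).symm
  let B : Finset (Fin n →₀ ℕ) := Finset.finsuppAntidiag Finset.univ n
  have hB : ∀ b : Fin n →₀ ℕ, b ∈ B ↔ ∑ i, b i = n := by
    intro b
    simp [B, Finset.mem_finsuppAntidiag]
  -- the Frobenius characteristic of `sgn · f`, in `n` variables
  let Q : MvPolynomial (Fin n) ℤ := ∑ b ∈ B, monomial b (z b)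
  have hQ : ∀ b : Fin n →₀ ℕ, coeff b Q = if ∑ i, b i = n then z b else 0 := by
    intro b
    simp only [Q, coeff_sum, coeff_monomial, Finset.sum_ite_eq', hB]
  have hsymm : Q ∈ symmetricSubalgebra (Fin n) ℤ := by
    rw [mem_symmetricSubalgebra]
    intro e
    ext b
    obtain ⟨b, rfl⟩ : ∃ b', Finsupp.mapDomain e b' = b :=
      ⟨Finsupp.mapDomain e.symm b, by rw [← Finsupp.mapDomain_comp]; simp⟩
    rw [coeff_rename_mapDomain _ e.injective, hQ, hQ]
    have hb : (b : Fin n → ℕ) = (Finsupp.mapDomain e b : Fin n →₀ ℕ) ∘ e := by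
      funext i
      simp [Finsupp.mapDomain_apply e.injective]
    have hsum : ∑ i, (Finsupp.mapDomain e b : Fin n →₀ ℕ) i = ∑ i, b i := by
      rw [hb]
      exact (Equiv.sum_comp e _).symm
    rw [hsum, hb, hzperm]
  obtain ⟨T, hT⟩ := esymmAlgHom_surjective (σ := Fin n) (n := n) ℤ (by simp) ⟨Q, hsymm⟩
  have hT' : Q = ∑ m ∈ T.support, C (T.coeff m) *
      ∏ c : (Σ i : Fin n, Fin (m i)), esymm (Fin n) ℤ (c.1 + 1) := by
    have h := esymmAlgHom_apply (σ := Fin n) T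
    rw [hT, aeval_def, eval₂_eq'] at h
    refine h.trans (Finset.sum_congr rfl fun m _ => ?_)
    rw [Fintype.prod_sigma]
    simp [algebraMap_eq]
  -- the Young character with `m i` colours of content `i + 1` for each `i`
  let φ : (Fin n →₀ ℕ) → symmCharacterRing n := fun m =>
    youngChar n (fun c : (Σ i : Fin n, Fin (m i)) => (c.1 : ℕ) + 1)
  have hpair : ∀ (m b : Fin n →₀ ℕ), ∑ i, b i = n →
      ∑ w, (signChar n * φ m).1 w * (youngChar n b).1 w = n.factorial *
        ((coeff b (∏ c : (Σ i : Fin n, Fin (m i)), esymm (Fin n) ℤ (c.1 + 1)) : ℤ) : ℂ) := by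
    intro m b hb
    have h := sum_sign_mul_invariantColorings (n := n)
      (fun c : (Σ i : Fin n, Fin (m i)) => (c.1 : ℕ) + 1) (b : Fin n → ℕ)
    rw [card_injective_pairColorings _ _ hb] at h
    rw [coeff_prod_esymm (fun c : (Σ i : Fin n, Fin (m i)) => (c.1 : ℕ) + 1) b]
    have h' := congrArg (fun z : ℤ => (z : ℂ)) h
    push_cast at h' ⊢
    rw [← h']
    refine Finset.sum_congr rfl fun w _ => ?_
    rw [← mul_assoc]
    rfl
  have hzero : signChar n * (f - ∑ m ∈ T.support, T.coeff m • φ m) = 0 := by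
    refine symmCharacterRing.eq_zero_of_forall_sum fun b hb => ?_
    obtain ⟨b, rfl⟩ : ∃ b' : Fin n →₀ ℕ, (b' : Fin n → ℕ) = b :=
      ⟨Finsupp.equivFunOnFinite.symm b, rfl⟩
    have h1 : ∀ w, (signChar n * (f - ∑ m ∈ T.support, T.coeff m • φ m)).1 w *
        (youngChar n b).1 w = (signChar n * f).1 w * (youngChar n b).1 w -
          ∑ m ∈ T.support,
            ((T.coeff m : ℤ) : ℂ) * ((signChar n * φ m).1 w * (youngChar n b).1 w) := by
      intro w
      let ψ : symmCharacterRing n →+* ℂ :=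
        (Pi.evalRingHom (fun _ : Equiv.Perm (Fin n) => ℂ) w).comp (Subring.subtype _)
      change ψ (signChar n * (f - ∑ m ∈ T.support, T.coeff m • φ m)) * ψ (youngChar n b) =
        ψ (signChar n * f) * ψ (youngChar n b) - ∑ m ∈ T.support,
          ((T.coeff m : ℤ) : ℂ) * (ψ (signChar n * φ m) * ψ (youngChar n b))
      simp only [map_mul, map_sub, map_sum, map_intCast, mul_sub, sub_mul, Finset.mul_sum,
        Finset.sum_mul, zsmul_eq_mul]
      congr 1
      exact Finset.sum_congr rfl fun m _ => by ring
    have h2 := hQ b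
    rw [if_pos hb, hT', coeff_sum] at h2
    simp only [coeff_C_mul] at h2
    rw [Finset.sum_congr rfl fun w _ => h1 w, Finset.sum_sub_distrib, hz, Finset.sum_comm, ← h2]
    simp only [← Finset.mul_sum]
    rw [Finset.sum_congr rfl fun m _ =>
      congrArg (((T.coeff m : ℤ) : ℂ) * ·) (hpair m b hb)]
    push_cast
    rw [Finset.mul_sum, sub_eq_zero]
    exact Finset.sum_congr rfl fun m _ => by ring
  have hsq : signChar n * signChar n = 1 := by
    refine Subtype.ext (funext fun w => ?_)
    change (signChar n).1 w * (signChar n).1 w = 1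
    rw [signChar_apply, ← Int.cast_mul, ← Units.val_mul, Int.units_mul_self]
    simp
  have hf : f = ∑ m ∈ T.support, T.coeff m • φ m := by
    have := congrArg (signChar n * ·) hzero
    simp only [← mul_assoc, hsq, one_mul, mul_zero] at this
    exact sub_eq_zero.mp this
  rw [hf]
  exact Submodule.sum_mem _ fun m _ => Submodule.smul_mem _ _ (youngChar_mem_span _)

/-! ### Values modulo `p` -/

theorem exists_intCast_eq_apply {n : ℕ} (w : Equiv.Perm (Fin n)) (f : symmCharacterRing n) :
    ∃ z : ℤ, (z : ℂ) = f.1 w := by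
  induction mem_span_partitionChar f using Submodule.span_induction with
  | mem f hf =>
    obtain ⟨l, rfl⟩ := hf
    exact ⟨_, Int.cast_natCast _⟩
  | zero => exact ⟨0, by simp⟩
  | add f g _ _ hf hg =>
    obtain ⟨y, hy⟩ := hf
    obtain ⟨z, hz⟩ := hg
    exact ⟨y + z, by push_cast; rw [hy, hz]; rfl⟩
  | smul k f _ hf =>
    obtain ⟨y, hy⟩ := hf
    refine ⟨k * y, ?_⟩
    push_cast
    rw [hy, zsmul_eq_mul]
    rfl

/-- Evaluation of virtual characters of the symmetric group at `w`, as a map to the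
integers. The values are integers because the Young characters span. -/
def valueHom {n : ℕ} (w : Equiv.Perm (Fin n)) : symmCharacterRing n →+* ℤ where
  toFun f := (exists_intCast_eq_apply w f).choose
  map_one' := Int.cast_injective (α := ℂ)
    ((exists_intCast_eq_apply w 1).choose_spec.trans Int.cast_one.symm)
  map_zero' := Int.cast_injective (α := ℂ)
    ((exists_intCast_eq_apply w 0).choose_spec.trans Int.cast_zero.symm)
  map_mul' f g := Int.cast_injective (α := ℂ) (by
    rw [Int.cast_mul, (exists_intCast_eq_apply w f).choose_spec,
      (exists_intCast_eq_apply w g).choose_spec]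
    exact (exists_intCast_eq_apply w (f * g)).choose_spec)
  map_add' f g := Int.cast_injective (α := ℂ) (by
    rw [Int.cast_add, (exists_intCast_eq_apply w f).choose_spec,
      (exists_intCast_eq_apply w g).choose_spec]
    exact (exists_intCast_eq_apply w (f + g)).choose_spec)

theorem cast_valueHom {n : ℕ} (w : Equiv.Perm (Fin n)) (f : symmCharacterRing n) :
    ((valueHom w f : ℤ) : ℂ) = f.1 w :=
  (exists_intCast_eq_apply w f).choose_spec

theorem valueHom_youngChar {n : ℕ} {C : Type} [Finite C] (w : Equiv.Perm (Fin n)) (a : C → ℕ) :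
    valueHom w (youngChar n a) = Nat.card (invariantColorings w a) := by
  have h := cast_valueHom w (youngChar n a)
  rw [youngChar_apply] at h
  exact_mod_cast h

theorem IsPSingular.dvd_valueHom {p n : ℕ} [Fact p.Prime] {C : Type} [Finite C] {a : C → ℕ}
    (ha : IsPSingular p a) (w : Equiv.Perm (Fin n)) : (p : ℤ) ∣ valueHom w (youngChar n a) := by
  have hp : p.Prime := Fact.out
  -- some power of the Young character is divisible by `p`
  obtain ⟨f, hf⟩ := exists_prod_youngChar_eq (p := p) (n := n) (ι := Fin (n + 1))
    (by rw [Fintype.card_fin]; nlinarith [hp.two_le]) (fun _ => a) (fun _ => ha)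
  have h := congrArg (valueHom w) hf
  rw [Finset.prod_const, map_pow, map_nsmul] at h
  have hdvd : (p : ℤ) ∣ valueHom w (youngChar n a) ^ (Finset.univ : Finset (Fin (n + 1))).card := by
    rw [h]
    exact ⟨valueHom w f, by simp⟩
  exact (Nat.prime_iff_prime_int.mp hp).dvd_of_dvd_pow hdvd

theorem exists_colorContent_eq {n : ℕ} {C : Type} [Fintype C] (a : C → ℕ) (ha : ∑ i, a i = n) :
    ∃ c : Fin n → C, colorContent c = a := by
  have e : Fin n ≃ Σ i, Fin (a i) := Fintype.equivOfCardEq (by simp [ha])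
  refine ⟨fun x => (e x).1, funext fun i => ?_⟩
  rw [colorContent, Nat.card_congr (e.subtypeEquiv (q := fun y : Σ i, Fin (a i) => y.1 = i)
    fun _ => Iff.rfl)]
  have hb : Function.Bijective
      (fun t : Fin (a i) => (⟨⟨i, t⟩, rfl⟩ : {y : Σ i, Fin (a i) // y.1 = i})) := by
    constructor
    · intro t u h
      simpa using congrArg Subtype.val h
    · rintro ⟨⟨_, t⟩, rfl⟩
      exact ⟨t, rfl⟩
  rw [← Nat.card_eq_of_bijective _ hb, Nat.card_eq_fintype_card, Fintype.card_fin]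

/-- A partition is `p`-singular if `p` of its parts are equal. -/
abbrev Nat.Partition.IsPSingular (p : ℕ) {n : ℕ} (l : n.Partition) : Prop :=
  _root_.IsPSingular p (fun x : l.parts.ToType => x.1)

/-- Every partition is the cycle type of some permutation. -/
theorem Nat.Partition.exists_isCycleColoring {n : ℕ} (l : n.Partition) :
    ∃ (w : Equiv.Perm (Fin n)) (c : Fin n → l.parts.ToType), IsCycleColoring w c ∧
      Function.Surjective c ∧ colorContent c = fun x => x.1 := by
  obtain ⟨c, hc⟩ := exists_colorContent_eq (n := n) (fun x : l.parts.ToType => x.1) (by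
    conv_rhs => rw [← l.parts_sum, ← Multiset.map_univ_coe l.parts]
    rfl)
  obtain ⟨w, hw⟩ := _root_.exists_isCycleColoring c
  refine ⟨w, c, hw, surjective_of_colorContent_ne_zero fun x => ?_, hc⟩
  rw [hc]
  exact (l.parts_pos (Multiset.coe_mem (x := x))).ne'

/-- The Young character of a partition `m` vanishes on the permutations whose cycle type is a
different partition with at most as many parts as `m`. -/
theorem eq_of_valueHom_partitionChar_ne_zero {n : ℕ} {l m : n.Partition} {w : Equiv.Perm (Fin n)}
    {c : Fin n → l.parts.ToType} (hw : IsCycleColoring w c) (hs : Function.Surjective c)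
    (hc : colorContent c = fun x => x.1)
    (hle : Nat.card l.parts.ToType ≤ Nat.card m.parts.ToType)
    (h : valueHom w (partitionChar m) ≠ 0) : m = l := by
  rw [partitionChar, valueHom_youngChar, Nat.cast_ne_zero] at h
  obtain ⟨⟨d, hd, hd'⟩⟩ := (Nat.card_ne_zero.mp h).1
  have hds : Function.Surjective d := surjective_of_colorContent_ne_zero fun x => by
    rw [hd']
    exact (m.parts_pos (Multiset.coe_mem (x := x))).ne'
  obtain ⟨τ, rfl⟩ := hw.exists_equiv hs hd hds hle
  have hτ : ∀ x, (τ x).1 = x.1 := by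
    intro x
    have h1 := colorContent_comp_injective c τ.injective x
    rw [hd', hc] at h1
    exact h1
  apply Nat.Partition.ext
  rw [← Multiset.map_univ_coe m.parts, ← Multiset.map_univ_coe l.parts,
    ← Finset.map_univ_equiv τ, Finset.map_val, Multiset.map_map]
  exact Multiset.map_congr rfl fun x _ => hτ x

/-- If an integral combination of the Young characters of partitions has all its values divisible
by `p`, then the coefficients of the `p`-regular partitions are divisible by `p`. -/
theorem dvd_coeff_of_forall_dvd_valueHom {p n : ℕ} [Fact p.Prime] (k : n.Partition → ℤ)
    (h : ∀ w, (p : ℤ) ∣ valueHom w (∑ l, k l • partitionChar l)) (l : n.Partition)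
    (hl : ¬ l.IsPSingular p) : (p : ℤ) ∣ k l := by
  classical
  have hp : Prime (p : ℤ) := Nat.prime_iff_prime_int.mp Fact.out
  by_contra hkl
  -- a counterexample with the least possible number of parts
  obtain ⟨l, hl, hmin⟩ := Finset.exists_min_image
    (Finset.univ.filter fun l : n.Partition => ¬ l.IsPSingular p ∧ ¬ (p : ℤ) ∣ k l)
    (fun l => Nat.card l.parts.ToType) ⟨l, by simpa using ⟨hl, hkl⟩⟩
  simp only [Finset.mem_filter, Finset.mem_univ, true_and] at hl hmin
  obtain ⟨w, c, hw, hs, hc⟩ := l.exists_isCycleColoring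
  have h1 := h w
  simp only [map_sum, map_zsmul] at h1
  rw [← Finset.add_sum_erase _ _ (Finset.mem_univ l)] at h1
  have h2 : (p : ℤ) ∣ ∑ m ∈ Finset.univ.erase l, k m • valueHom w (partitionChar m) := by
    refine Finset.dvd_sum fun m hm => ?_
    rw [smul_eq_mul]
    by_cases hsing : m.IsPSingular p
    · exact (hsing.dvd_valueHom w).mul_left _
    by_cases hkm : (p : ℤ) ∣ k m
    · exact hkm.mul_right _
    by_cases h0 : valueHom w (partitionChar m) = 0
    · simp [h0]
    · exact ((Finset.ne_of_mem_erase hm)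
        (eq_of_valueHom_partitionChar_ne_zero hw hs hc (hmin m ⟨hsing, hkm⟩) h0)).elim
  have h3 := (dvd_add_left h2).mp h1
  rw [smul_eq_mul] at h3
  rcases hp.dvd_or_dvd h3 with h4 | h4
  · exact hl.2 h4
  · rw [partitionChar, valueHom_youngChar, Int.natCast_dvd_natCast] at h4
    rw [← hc] at h4
    exact hw.not_dvd_card_invariantColorings hs (by rw [hc]; exact hl.1) h4

/-! ### The radical of `𝓡ₙ / p𝓡ₙ` -/

/-- The quotient map `𝓡ₙ → 𝓡ₙ / p𝓡ₙ`. -/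
abbrev symmCharacterRingMod.mk (n p : ℕ) : symmCharacterRing n →+* symmCharacterRingMod n p :=
  Ideal.Quotient.mk _

theorem symmCharacterRingMod.mk_eq_zero_iff {n p : ℕ} {f : symmCharacterRing n} :
    symmCharacterRingMod.mk n p f = 0 ↔ ∃ g, f = p * g := by
  rw [Ideal.Quotient.eq_zero_iff_mem, Ideal.mem_span_singleton]
  rfl

/-- The values of a virtual character in the radical are divisible by `p`, since evaluation modulo
`p` is a homomorphism onto a field. -/
theorem dvd_valueHom_of_mem_jacobson {n p : ℕ} [Fact p.Prime] {f : symmCharacterRing n}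
    (hf : symmCharacterRingMod.mk n p f ∈ Ring.jacobson (symmCharacterRingMod n p))
    (w : Equiv.Perm (Fin n)) : (p : ℤ) ∣ valueHom w f := by
  let ψ : symmCharacterRingMod n p →+* ZMod p :=
    Ideal.Quotient.lift _ ((Int.castRingHom (ZMod p)).comp (valueHom w)) (by
      intro g hg
      obtain ⟨g, rfl⟩ := Ideal.mem_span_singleton.mp hg
      simp)
  have hψ : Function.Surjective ψ := ZMod.ringHom_surjective ψ
  have := RingHom.ker_isMaximal_of_surjective ψ hψ
  have h : symmCharacterRingMod.mk n p f ∈ RingHom.ker ψ :=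
    Ring.jacobson_le_of_isMaximal (RingHom.ker ψ) hf
  rw [RingHom.mem_ker] at h
  exact (ZMod.intCast_zmod_eq_zero_iff_dvd _ _).mp h

/-- The radical lies in the ideal generated by the Young characters of `p`-singular partitions: in
an integral combination of Young characters with all values divisible by `p`, the terms of
`p`-regular partitions vanish modulo `p`. -/
theorem jacobson_le_span_partitionChar (n p : ℕ) [Fact p.Prime] :
    Ring.jacobson (symmCharacterRingMod n p) ≤ Ideal.span
      ((fun l => symmCharacterRingMod.mk n p (partitionChar l)) ''
        {l : n.Partition | l.IsPSingular p}) := by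
  intro x hx
  obtain ⟨f, rfl⟩ := Ideal.Quotient.mk_surjective x
  obtain ⟨k, rfl⟩ := (Submodule.mem_span_range_iff_exists_fun ℤ).mp (mem_span_partitionChar f)
  have hk := dvd_coeff_of_forall_dvd_valueHom k (dvd_valueHom_of_mem_jacobson hx)
  rw [map_sum]
  refine Ideal.sum_mem _ fun l _ => ?_
  rw [zsmul_eq_mul, map_mul]
  by_cases hl : l.IsPSingular p
  · exact Ideal.mul_mem_left _ _ (Ideal.subset_span ⟨l, hl, rfl⟩)
  · obtain ⟨j, hj⟩ := hk l hl
    have : symmCharacterRingMod.mk n p ((k l : ℤ) : symmCharacterRing n) = 0 :=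
      symmCharacterRingMod.mk_eq_zero_iff.mpr ⟨j, by rw [hj]; push_cast; rfl⟩
    rw [this, zero_mul]
    exact zero_mem _

theorem jacobson_pow_eq_bot (n p : ℕ) [Fact p.Prime] :
    Ring.jacobson (symmCharacterRingMod n p) ^ (n / p + 1) = ⊥ := by
  have hp : p.Prime := Fact.out
  rw [eq_bot_iff]
  refine (Ideal.pow_right_mono (jacobson_le_span_partitionChar n p) _).trans ?_
  change Submodule.span _ _ ^ _ ≤ _
  rw [Submodule.span_pow, Submodule.span_le]
  intro x hx
  obtain ⟨f, rfl⟩ := Set.mem_pow.mp hx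
  choose l hl hlf using fun j => (f j).2
  obtain ⟨g, hg⟩ := exists_prod_youngChar_eq (p := p) (n := n) (ι := Fin (n / p + 1))
    (by rw [Fintype.card_fin]; exact Nat.lt_mul_div_succ n hp.pos) _ hl
  have h0 : symmCharacterRingMod.mk n p (∏ j, partitionChar (l j)) = 0 :=
    symmCharacterRingMod.mk_eq_zero_iff.mpr ⟨g, by rw [← nsmul_eq_mul]; exact hg⟩
  rw [map_prod] at h0
  rw [List.prod_ofFn, SetLike.mem_coe, Submodule.mem_bot, ← h0]
  exact Finset.prod_congr rfl fun j _ => (hlf j).symm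

open Polynomial in
/-- The class of the falling factorial `(x)_p` lies in the radical, because its powers are the
classes of the `(x)_{pk}`, which vanish for large `k`. -/
theorem aeval_descPochhammer_mem_jacobson (n p : ℕ) [Fact p.Prime] :
    symmCharacterRingMod.mk n p (aeval (fixedPointChar n) (descPochhammer ℤ p)) ∈
      Ring.jacobson (symmCharacterRingMod n p) := by
  have hp : p.Prime := Fact.out
  have hnil : symmCharacterRingMod.mk n p
      (aeval (fixedPointChar n) (descPochhammer ℤ p)) ^ (n + 1) = 0 := by
    obtain ⟨H, hH⟩ := exists_descPochhammer_pow_eq p (n + 1)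
    rw [← map_pow, ← map_pow, hH, symmCharacterRingMod.mk_eq_zero_iff]
    refine ⟨aeval (fixedPointChar n) H, ?_⟩
    rw [map_add, aeval_descPochhammer_fixedPointChar_eq_zero (by nlinarith [hp.two_le]), zero_add,
      map_mul, map_natCast]
  rw [Ring.jacobson_eq_sInf_isMaximal, Ideal.mem_sInf]
  intro m hm
  refine (Ideal.IsMaximal.isPrime hm).mem_of_pow_mem (n + 1) ?_
  rw [hnil]
  exact zero_mem _

open Polynomial in
theorem jacobson_pow_ne_bot (n p : ℕ) [Fact p.Prime] :
    Ring.jacobson (symmCharacterRingMod n p) ^ (n / p) ≠ ⊥ := by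
  have hp : p.Prime := Fact.out
  intro hbot
  have h := Ideal.pow_mem_pow (aeval_descPochhammer_mem_jacobson n p) (n / p)
  obtain ⟨H, hH⟩ := exists_descPochhammer_pow_eq p (n / p)
  rw [hbot, Ideal.mem_bot, ← map_pow, ← map_pow, hH, symmCharacterRingMod.mk_eq_zero_iff] at h
  obtain ⟨g, hg⟩ := h
  rw [map_add, map_mul, map_natCast, ← eq_sub_iff_add_eq, ← mul_sub] at hg
  -- the left side has average `1`, the right side `p` times an integer
  have h1 := sum_aeval_descPochhammer_fixedPointChar (n := n) (j := p * (n / p))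
    (Nat.mul_div_le n p)
  obtain ⟨z, hz⟩ := virtualCharacterRing.exists_sum_eq (g - aeval (fixedPointChar n) H).2
  rw [hg] at h1
  have h2 : ∀ w, ((p : symmCharacterRing n) * (g - aeval (fixedPointChar n) H)).1 w =
      p * (g - aeval (fixedPointChar n) H).1 w := fun w => rfl
  rw [Finset.sum_congr rfl fun w _ => h2 w, ← Finset.mul_sum, hz, mul_left_comm] at h1
  have h3 : (Fintype.card (Equiv.Perm (Fin n)) : ℂ) ≠ 0 := by
    exact_mod_cast Fintype.card_ne_zero
  have h4 : (p : ℂ) * z = 1 := mul_left_cancel₀ h3 (h1.trans (mul_one _).symm)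
  have h5 : (p : ℤ) * z = 1 := by exact_mod_cast h4
  exact (Nat.prime_iff_prime_int.mp hp).not_isUnit (IsUnit.of_mul_eq_one _ h5)

end

theorem corollaryB (p n : ℕ) [Fact p.Prime] (hn : n ≠ 0) :
    loewyLength (ZMod p) (symmCharacterRingMod n p) = ((n / p + 1 : ℕ) : ℕ∞) := by
  refine le_antisymm (iInf₂_le (n / p + 1) (jacobson_pow_eq_bot n p)) (le_iInf₂ fun l hl => ?_)
  rw [Nat.cast_le]
  by_contra! hlt
  exact jacobson_pow_ne_bot n p (le_bot_iff.mp (hl ▸ Ideal.pow_le_pow_right (by omega)))
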